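/- **MILP reformulation of W-DHRAS.** Let $N,R\ge 1$, $[n]=\{1,\dots,n\}$, $[a,b]_{\mathbb Z}=\{a,\dots,b\}$. Customers are $1,\dots,N$ and $0$ is the depot. Data: working time $L\ge 0$; unit costs $c^w_j,c^u_j\ge 0$ ($j\in[N]$) of waiting and idling, $c^o\ge 0$ of overtime, $\lambda\ge 0$ of travel, with $c^u_{j+1}\le c^u_j+c^w_j$ for $j\in[N-1]$; bounds $\underline t_{i,i'},\overline t_{i,i'}$ ($i\ne i'$ in $[0,N]_{\mathbb Z}$) and $\underline d_i,\overline d_i$ ($i\in[N]$) with nonnegative lower bounds. The support $\mathcal S$ is the set of nonnegative vectors $\xi=(t,d)$ with $\underline t_{i,i'}\le t_{i,i'}\le\overline t_{i,i'}$ and $\underline d_i\le d_i\le\overline d_i$. Let $\hat\xi^1,\dots,\hat\xi^R\in\mathcal S$, $\hat{\mathbb P}=\frac1R\sum_r\delta_{\hat\xi^r}$ and $\epsilon>0$. Let $\mathcal X$ be the set of $0/1$ matrices $(x_{i,j})_{i,j\in[N]}$ with all row and column sums $1$ ($x_{i,j}=1$ iff customer $i$ is served in position $j$), and $\mathcal A=\{a\in[0,L]^N: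 a_1\le\dots\le a_N\}$. Put $x_{i,N+1}=0$, $a_{N+1}=L$. For $(x,a)\in\mathcal X\times\mathcal A$ let $$f(x,a,\xi)=\min_{u,w\ge 0}\ \sum_{j=1}^N(c^w_jw_j+c^u_ju_j)+c^ow_{N+1}+\lambda\Big[\sum_{j=2}^N\sum_{i}\sum_{i'\ne i}t_{i,i'}x_{i,j-1}x_{i',j}+\sum_i(t_{0,i}x_{i,1}+t_{i,0}x_{i,N})\Big]$$ subject to $w_1-u_1=\sum_i t_{0,i}x_{i,1}-a_1$; $\ w_j-w_{j-1}-u_j=a_{j-1}-a_j+\sum_i d_ix_{i,j-1}+\sum_i\sum_{i'\ne i}t_{i,i'}x_{i,j-1}x_{i',j}$ for $j\in[2,N]_{\mathbb Z}$; $\ w_{N+1}-w_N-u_{N+1}=a_N-a_{N+1}+\sum_i d_ix_{i,N}$. The model W-DHRAS is $$\min_{x\in\mathcal X,\,a\in\mathcal A}\ F(x,a),\qquad F(x,a)=\sup_{\mathbb Q\in\mathcal P(\mathcal S),\ W_1(\mathbb Q,\hat{\mathbb P})\le\epsilon}\mathbb E_{\mathbb Q}[f(x,a,\xi)],$$ where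 $\mathcal P(\mathcal S)$ is the set of probability distributions on $\mathcal S$ and $W_1$ is the $1$-Wasserstein distance for the $\ell_1$ norm. Let $c^w_{N+1}=c^o$, $c^w_{N+2}=c^u_{N+1}=c^u_{N+2}=0$ and $\pi_{j,v}=-c^u_v+\sum_{l=j}^{v-1}c^w_l$ for $1\le j\le v\le N+2$. The MILP has the variables $x,a,\rho$, $\tau_{i,i',j-1,j}$, and for each $r\in[R]$ the variables $\beta^r\in\mathbb R^{N+2}$, $u^r_{i,0},\psi^r_{i,0}$; $u^r_{0,i,1,v},\sigma^r_{0,i,1,v}$; $u^r_{i,i',j,v},\phi^r_{i,i',j,v}$; $\nu^r_{i,j,v},\zeta^r_{i,j,v}$. It is $$\min\ \epsilon\rho+\frac1R\sum_{r=1}^R\Big(\sum_{i=1}^N\psi^r_{i,0}+\sum_{j=1}^{N+2}\beta^r_j\Big)$$ subject to $x\in\mathcal X$, $a\in\mathcal A$, $\rho\ge 0$ and, for all $r\in[R]$, the following, where $i\in[N]$, $i'\in[N]\setminus\{i\}$, $j\in[2,N+1]_{\mathbb Z}$, $v\in[j,N+2]_{\mathbb Z}$ (but $v\in[N+2]$ in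 items about $u^r_{0,i,1,v}$, $\sigma^r_{0,i,1,v}$), unless stated otherwise: 1. $\beta^r_1\ge -a_1\pi_{1,1}+\sum_i\sigma^r_{0,i,1,1}$ and $\beta^r_{N+2}\ge 0$; 2. for $v\in[2,N+2]_{\mathbb Z}$: $\sum_{j=1}^v\beta^r_j\ge -a_1\pi_{1,v}+\sum_i\sigma^r_{0,i,1,v}+\sum_{j=2}^{\min(v,N+1)}\big[(a_{j-1}-a_j)\pi_{j,v}+\sum_i\zeta^r_{i,j,v}+\sum_i\sum_{i'\ne i}\phi^r_{i,i',j,v}\big]$; 3. for $k\in[2,N+1]_{\mathbb Z}$, $v\in[k,N+2]_{\mathbb Z}$: $\sum_{j=k}^v\beta^r_j\ge\sum_{j=k}^{\min(v,N+1)}\big[(a_{j-1}-a_j)\pi_{j,v}+\sum_i\zeta^r_{i,j,v}+\sum_i\sum_{i'\ne i}\phi^r_{i,i',j,v}\big]$; 4. $u^r_{i,0}\ge\lambda\hat t^r_{i,0}$ and $u^r_{i,0}\ge\lambda\overline t_{i,0}-\rho(\overline t_{i,0}-\hat t^r_{i,0})$; 5. with $M_\rho(c;l,m,h)=\max\{cl-\rho(m-l),\,cm,\,ch-\rho(h-m)\}$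 (each lower bound below standing for three linear inequalities): $u^r_{0,i,1,v}\ge M_\rho(\pi_{1,v}+\lambda;\underline t_{0,i},\hat t^r_{0,i},\overline t_{0,i})$, $\ u^r_{i,i',j,v}\ge M_\rho(\pi_{j,v}+\lambda;\underline t_{i,i'},\hat t^r_{i,i'},\overline t_{i,i'})$, $\ \nu^r_{i,j,v}\ge M_\rho(\pi_{j,v};\underline d_i,\hat d^r_i,\overline d_i)$; 6. $\tau_{i,i',j-1,j}\ge x_{i,j-1}+x_{i',j}-1$, $\ \tau_{i,i',j-1,j}\ge 0$, $\ \tau_{i,i',j-1,j}\le x_{i,j-1}$, $\ \tau_{i,i',j-1,j}\le x_{i',j}$; 7. the McCormick inequalities $\underline y\,b\le z$, $\ y+\overline y(b-1)\le z$, $\ z\le\overline y\,b$, $\ z\le y+\underline y(b-1)$ for $(z,y,b)$ equal to $(\psi^r_{i,0},u^r_{i,0},x_{i,N})$, $(\sigma^r_{0,i,1,v},u^r_{0,i,1,v},x_{i,1})$, $(\phi^r_{i,i',j,v},u^r_{i,i',j,v},\tau_{i,i',j-1,j})$, $(\zeta^r_{i,j,v},\nu^r_{i,j,v},x_{i,j-1})$,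 with the bounds $\underline u^r_{i,0}=\lambda\hat t^r_{i,0}$, $\ \overline u^r_{i,0}=\lambda\overline t_{i,0}$; $\underline u^r_{0,i,1,v}=(\pi_{1,v}+\lambda)\hat t^r_{0,i}$, $\ \overline u^r_{0,i,1,v}=\max\{(\pi_{1,v}+\lambda)\underline t_{0,i},(\pi_{1,v}+\lambda)\overline t_{0,i}\}$; $\underline u^r_{i,i',j,v}=(\pi_{j,v}+\lambda)\hat t^r_{i,i'}$, $\ \overline u^r_{i,i',j,v}=\max\{(\pi_{j,v}+\lambda)\underline t_{i,i'},(\pi_{j,v}+\lambda)\overline t_{i,i'}\}$; $\underline\nu^r_{i,j,v}=\pi_{j,v}\hat d^r_i$, $\ \overline\nu^r_{i,j,v}=\max\{\pi_{j,v}\underline d_i,\pi_{j,v}\overline d_i\}$. Then W-DHRAS and the MILP are equivalent: (a) for all $(x,a)\in\mathcal X\times\mathcal A$, the minimum defining $f(x,a,\xi)$ is attained for every $\xi$, $f(x,a,\cdot)$ is integrable under every distribution of the ambiguity set, the supremum $F(x,a)$ is finite, and $F(x,a)$ is the attained minimum of the MILP objective over the feasible points of the MILP with these $(x,a)$; (b)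 W-DHRAS and the MILP both attain their minimum, and the two optimal values are equal; (c) $(x,a)$ is optimal for W-DHRAS if and only if it is the $(x,a)$-part of an optimal solution of the MILP; (d) at every feasible point of the MILP the linearisation is exact: $\tau_{i,i',j-1,j}=x_{i,j-1}x_{i',j}$, $\psi^r_{i,0}=u^r_{i,0}x_{i,N}$, $\sigma^r_{0,i,1,v}=u^r_{0,i,1,v}x_{i,1}$, $\phi^r_{i,i',j,v}=u^r_{i,i',j,v}x_{i,j-1}x_{i',j}$, $\zeta^r_{i,j,v}=\nu^r_{i,j,v}x_{i,j-1}$; (e) the bounds in 7 are tight: for each variable $u^r_{i,0},u^r_{0,i,1,v},u^r_{i,i',j,v},\nu^r_{i,j,v}$, they are the minimum and the maximum over $\rho\ge 0$ of the largest of the lower bounds imposed on that variable in 4 and 5. -/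

import Mathlib

open MeasureTheory
open scoped ENNReal

noncomputable section

/-- Directed arcs `(i, i')`, `i ≠ i'`, between the locations `0, 1, …, N`; location `0` is the depot
and customer `i : Fin N` sits at location `i.succ`. -/
abbrev Arc (N : ℕ) := {p : Fin (N + 1) × Fin (N + 1) // p.1 ≠ p.2}

/-- A realization `ξ = (t, d)` of the travel times and of the service times. -/
abbrev Scenario (N : ℕ) := (Arc N → ℝ) × (Fin N → ℝ)

/-- The travel time `t_{i,i'}`; only ever used with `i ≠ i'`. -/
def Scenario.travel {N : ℕ} (ξ : Scenario N) (i i' : Fin (N + 1)) : ℝ :=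
  if h : i ≠ i' then ξ.1 ⟨(i, i'), h⟩ else 0

/-- The service time `d_i` of customer `i`. -/
def Scenario.service {N : ℕ} (ξ : Scenario N) (i : Fin N) : ℝ := ξ.2 i

/-- The `ℓ₁` distance of two realizations. -/
def l1dist {N : ℕ} (ξ ξ' : Scenario N) : ℝ :=
  ∑ p, |ξ.1 p - ξ'.1 p| + ∑ i, |ξ.2 i - ξ'.2 i|

/-- The `j`-th entry of a vector, counted from `1`; it is `0` outside the range `1, …, n`. -/
def ent {n : ℕ} (f : Fin n → ℝ) (j : ℕ) : ℝ :=
  if h : 1 ≤ j ∧ j ≤ n then f ⟨j - 1, by omega⟩ else 0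

/-- The `(j, v)` entry of a matrix, both indices counted from `1`. -/
def ent₂ {m n : ℕ} (f : Fin m → Fin n → ℝ) (j v : ℕ) : ℝ :=
  ent (fun j' => ent (f j') v) j

/-- The deterministic data of the problem: working time `L`, unit waiting costs `cw`, unit idling
costs `cu`, unit overtime cost `co`, unit travel cost `lam`, and the vectors of lower and upper
bounds of the travel and service times. -/
structure HRASData (N : ℕ) where
  L : ℝ
  cw : Fin N → ℝ
  cu : Fin N → ℝ
  co : ℝ
  lam : ℝ
  lo : Scenario N
  hi : Scenario N

/-- The set `𝒳` of assignments: `x i j = 1` iff customer `i` is the `j`-th one served. Through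
`ent`, positions are counted from `1` and `x_{i,N+1} = 0`. -/
def IsRoute {N : ℕ} (x : Fin N → Fin N → ℝ) : Prop :=
  (∀ j, ∑ i, x i j = 1) ∧ (∀ i, ∑ j, x i j = 1) ∧ ∀ i j, x i j = 0 ∨ x i j = 1

/-- Total travel time of the route `x` under `ξ`. -/
def travelTotal {N : ℕ} (x : Fin N → Fin N → ℝ) (ξ : Scenario N) : ℝ :=
  ∑ j ∈ Finset.Icc 2 N, ∑ i, ∑ i' ∈ Finset.univ.erase i,
      ξ.travel i.succ i'.succ * ent (x i) (j - 1) * ent (x i') j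
    + ∑ i, (ξ.travel 0 i.succ * ent (x i) 1 + ξ.travel i.succ 0 * ent (x i) N)

/-- The `1`-Wasserstein distance with respect to the `ℓ₁` norm: the infimum of the transportation
cost over all couplings. -/
def wasserstein₁ {N : ℕ} (Q₁ Q₂ : Measure (Scenario N)) : ℝ≥0∞ :=
  ⨅ (P : Measure (Scenario N × Scenario N)) (_ : P.map Prod.fst = Q₁ ∧ P.map Prod.snd = Q₂),
    ∫⁻ p, ENNReal.ofReal (l1dist p.1 p.2) ∂P

/-- The empirical distribution of `R` samples. -/
def empirical {N R : ℕ} (s : Fin R → Scenario N) : Measure (Scenario N) :=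
  (R : ℝ≥0∞)⁻¹ • ∑ r, Measure.dirac (s r)

/-- The four McCormick inequalities for a product `z = u * b`, where `b ∈ [0, 1]` and
`l ≤ u ≤ h`. -/
def McCormick (z u b l h : ℝ) : Prop :=
  l * b ≤ z ∧ u + h * (b - 1) ≤ z ∧ z ≤ h * b ∧ z ≤ u + l * (b - 1)

/-- The decision variables of the MILP. The index `j` of `τ i i' j` stands for `(j - 1, j)`;
`uRet r i`, `uOut r i v`, `uLink r i i' j v` are `u^r_{i,0}`, `u^r_{0,i,1,v}`, `u^r_{i,i',j,v}`.
Entries whose index lies outside the ranges of the model occur in no constraint. -/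
structure MILPVars (N R : ℕ) where
  x : Fin N → Fin N → ℝ
  a : Fin N → ℝ
  rho : ℝ
  β : Fin R → Fin (N + 2) → ℝ
  uRet : Fin R → Fin N → ℝ
  uOut : Fin R → Fin N → Fin (N + 2) → ℝ
  uLink : Fin R → Fin N → Fin N → Fin (N + 1) → Fin (N + 2) → ℝ
  ν : Fin R → Fin N → Fin (N + 1) → Fin (N + 2) → ℝ
  τ : Fin N → Fin N → Fin (N + 1) → ℝ
  ψ : Fin R → Fin N → ℝ
  σ : Fin R → Fin N → Fin (N + 2) → ℝ
  φ : Fin R → Fin N → Fin N → Fin (N + 1) → Fin (N + 2) → ℝ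
  ζ : Fin R → Fin N → Fin (N + 1) → Fin (N + 2) → ℝ

namespace HRASData

variable {N R : ℕ}

/-- Waiting costs extended by `c^w_{N+1} = c^o` (and `c^w_{N+2} = 0`). -/
def cwExt (D : HRASData N) (j : ℕ) : ℝ := if j = N + 1 then D.co else ent D.cw j

/-- Idling costs extended by `c^u_{N+1} = c^u_{N+2} = 0`. -/
def cuExt (D : HRASData N) (j : ℕ) : ℝ := ent D.cu j

/-- Appointment times extended by `a_{N+1} = L`. -/
def apt (D : HRASData N) (a : Fin N → ℝ) (j : ℕ) : ℝ := if j = N + 1 then D.L else ent a j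

/-- The set `𝒜` of schedules. -/
def IsSchedule (D : HRASData N) (a : Fin N → ℝ) : Prop :=
  (∀ j, 0 ≤ a j ∧ a j ≤ D.L) ∧ ∀ j ∈ Finset.Icc 2 N, ent a (j - 1) ≤ ent a j

/-- The rectangular support `𝒮`. -/
def support (D : HRASData N) : Set (Scenario N) :=
  {ξ | (∀ p, 0 ≤ ξ.1 p ∧ D.lo.1 p ≤ ξ.1 p ∧ ξ.1 p ≤ D.hi.1 p) ∧
       (∀ i, 0 ≤ ξ.2 i ∧ D.lo.2 i ≤ ξ.2 i ∧ ξ.2 i ≤ D.hi.2 i)}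

/-- Feasibility of idle times `u` and waiting times `w` in the second-stage linear program. -/
def SecondStageFeasible (D : HRASData N) (x : Fin N → Fin N → ℝ) (a : Fin N → ℝ)
    (ξ : Scenario N) (u w : Fin (N + 1) → ℝ) : Prop :=
  ent w 1 - ent u 1 = ∑ i, ξ.travel 0 i.succ * ent (x i) 1 - D.apt a 1 ∧
  (∀ j ∈ Finset.Icc 2 N, ent w j - ent w (j - 1) - ent u j =
    D.apt a (j - 1) - D.apt a j + ∑ i, ξ.service i * ent (x i) (j - 1)
      + ∑ i, ∑ i' ∈ Finset.univ.erase i,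
          ξ.travel i.succ i'.succ * ent (x i) (j - 1) * ent (x i') j) ∧
  ent w (N + 1) - ent w N - ent u (N + 1) =
    D.apt a N - D.apt a (N + 1) + ∑ i, ξ.service i * ent (x i) N ∧
  ∀ j, 0 ≤ w j ∧ 0 ≤ u j

/-- Objective of the second-stage linear program. -/
def secondStageObj (D : HRASData N) (x : Fin N → Fin N → ℝ) (ξ : Scenario N)
    (u w : Fin (N + 1) → ℝ) : ℝ :=
  ∑ j ∈ Finset.Icc 1 N, (ent D.cw j * ent w j + ent D.cu j * ent u j)
    + D.co * ent w (N + 1) + D.lam * travelTotal x ξ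

/-- All objective values of the second-stage linear program. -/
def secondStageValues (D : HRASData N) (x : Fin N → Fin N → ℝ) (a : Fin N → ℝ)
    (ξ : Scenario N) : Set ℝ :=
  {z | ∃ u w, D.SecondStageFeasible x a ξ u w ∧ z = D.secondStageObj x ξ u w}

/-- The second-stage cost `f(x, a, ξ)`. -/
def cost (D : HRASData N) (x : Fin N → Fin N → ℝ) (a : Fin N → ℝ) (ξ : Scenario N) : ℝ :=
  sInf (D.secondStageValues x a ξ)

/-- The `1`-Wasserstein ball of radius `ε` around the empirical distribution, within the
probability distributions on the support. -/
def ambiguitySet (D : HRASData N) (s : Fin R → Scenario N) (ε : ℝ) :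
    Set (Measure (Scenario N)) :=
  {Q | IsProbabilityMeasure Q ∧ Q D.supportᶜ = 0 ∧
       wasserstein₁ Q (empirical s) ≤ ENNReal.ofReal ε}

/-- The expected costs of `(x, a)` under the distributions of the ambiguity set. -/
def expectedCosts (D : HRASData N) (s : Fin R → Scenario N) (ε : ℝ)
    (x : Fin N → Fin N → ℝ) (a : Fin N → ℝ) : Set ℝ :=
  (fun Q : Measure (Scenario N) => ∫ ξ, D.cost x a ξ ∂Q) '' D.ambiguitySet s ε

/-- The worst-case expected cost of `(x, a)`. -/
def worstCase (D : HRASData N) (s : Fin R → Scenario N) (ε : ℝ)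
    (x : Fin N → Fin N → ℝ) (a : Fin N → ℝ) : ℝ :=
  sSup (D.expectedCosts s ε x a)

/-- The objective values of W-DHRAS over its feasible set `𝒳 × 𝒜`. -/
def wdhrasValues (D : HRASData N) (s : Fin R → Scenario N) (ε : ℝ) : Set ℝ :=
  {z | ∃ x a, IsRoute x ∧ D.IsSchedule a ∧ z = D.worstCase s ε x a}

/-- `(x, a)` is an optimal solution of W-DHRAS. -/
def IsWDHRASOptimal (D : HRASData N) (s : Fin R → Scenario N) (ε : ℝ)
    (x : Fin N → Fin N → ℝ) (a : Fin N → ℝ) : Prop :=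
  IsRoute x ∧ D.IsSchedule a ∧ D.worstCase s ε x a ∈ lowerBounds (D.wdhrasValues s ε)

/-- `π_{j,v} = - c^u_v + ∑_{l=j}^{v-1} c^w_l`. -/
def piC (D : HRASData N) (j v : ℕ) : ℝ := - D.cuExt v + ∑ l ∈ Finset.Ico j v, D.cwExt l

/-! Lower and upper bounds of the `u` and `ν` variables that belong to the sample `s`. -/

def uRetLo (D : HRASData N) (s : Scenario N) (i : Fin N) : ℝ :=
  D.lam * s.travel i.succ 0

def uRetHi (D : HRASData N) (i : Fin N) : ℝ :=
  D.lam * D.hi.travel i.succ 0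

def uOutLo (D : HRASData N) (s : Scenario N) (i : Fin N) (v : ℕ) : ℝ :=
  (D.piC 1 v + D.lam) * s.travel 0 i.succ

def uOutHi (D : HRASData N) (i : Fin N) (v : ℕ) : ℝ :=
  max ((D.piC 1 v + D.lam) * D.lo.travel 0 i.succ) ((D.piC 1 v + D.lam) * D.hi.travel 0 i.succ)

def uLinkLo (D : HRASData N) (s : Scenario N) (i i' : Fin N) (j v : ℕ) : ℝ :=
  (D.piC j v + D.lam) * s.travel i.succ i'.succ

def uLinkHi (D : HRASData N) (i i' : Fin N) (j v : ℕ) : ℝ :=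
  max ((D.piC j v + D.lam) * D.lo.travel i.succ i'.succ)
    ((D.piC j v + D.lam) * D.hi.travel i.succ i'.succ)

def νLo (D : HRASData N) (s : Scenario N) (i : Fin N) (j v : ℕ) : ℝ :=
  D.piC j v * s.service i

def νHi (D : HRASData N) (i : Fin N) (j v : ℕ) : ℝ :=
  max (D.piC j v * D.lo.service i) (D.piC j v * D.hi.service i)

/-! The explicit values, as functions of `rho`, which the `u` and `ν` variables bound from above. -/

def uRetVal (D : HRASData N) (s : Scenario N) (i : Fin N) (rho : ℝ) : ℝ :=
  max (D.lam * s.travel i.succ 0)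
    (D.lam * D.hi.travel i.succ 0 - rho * (D.hi.travel i.succ 0 - s.travel i.succ 0))

/-- `max {c l - ρ (m - l), c m, c h - ρ (h - m)}`. -/
def maxVal (c l m h rho : ℝ) : ℝ :=
  max (max (c * l - rho * (m - l)) (c * m)) (c * h - rho * (h - m))

def uOutVal (D : HRASData N) (s : Scenario N) (i : Fin N) (v : ℕ) (rho : ℝ) : ℝ :=
  maxVal (D.piC 1 v + D.lam) (D.lo.travel 0 i.succ) (s.travel 0 i.succ) (D.hi.travel 0 i.succ) rho

def uLinkVal (D : HRASData N) (s : Scenario N) (i i' : Fin N) (j v : ℕ) (rho : ℝ) : ℝ :=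
  maxVal (D.piC j v + D.lam) (D.lo.travel i.succ i'.succ) (s.travel i.succ i'.succ)
    (D.hi.travel i.succ i'.succ) rho

def νVal (D : HRASData N) (s : Scenario N) (i : Fin N) (j v : ℕ) (rho : ℝ) : ℝ :=
  maxVal (D.piC j v) (D.lo.service i) (s.service i) (D.hi.service i) rho

/-- Objective of the MILP. -/
def milpObj (_D : HRASData N) (ε : ℝ) (y : MILPVars N R) : ℝ :=
  ε * y.rho + (R : ℝ)⁻¹ * ∑ r, (∑ i, y.ψ r i + ∑ j ∈ Finset.Icc 1 (N + 2), ent (y.β r) j)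

/-- Constraints of the MILP. All of them are linear, apart from `x` being binary. -/
structure MILPFeasible (D : HRASData N) (s : Fin R → Scenario N) (y : MILPVars N R) : Prop where
  route : IsRoute y.x
  schedule : D.IsSchedule y.a
  rho_nonneg : 0 ≤ y.rho
  mc_τ : ∀ i, ∀ i' ∈ Finset.univ.erase i, ∀ j ∈ Finset.Icc 2 (N + 1),
    ent (y.x i) (j - 1) + ent (y.x i') j - 1 ≤ ent (y.τ i i') j ∧ 0 ≤ ent (y.τ i i') j ∧
    ent (y.τ i i') j ≤ ent (y.x i) (j - 1) ∧ ent (y.τ i i') j ≤ ent (y.x i') j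
  mc_ψ : ∀ r i, McCormick (y.ψ r i) (y.uRet r i) (ent (y.x i) N)
    (D.uRetLo (s r) i) (D.uRetHi i)
  mc_φ : ∀ r i, ∀ i' ∈ Finset.univ.erase i, ∀ j ∈ Finset.Icc 2 (N + 1),
    ∀ v ∈ Finset.Icc j (N + 2),
    McCormick (ent₂ (y.φ r i i') j v) (ent₂ (y.uLink r i i') j v) (ent (y.τ i i') j)
      (D.uLinkLo (s r) i i' j v) (D.uLinkHi i i' j v)
  mc_σ : ∀ r i, ∀ v ∈ Finset.Icc 1 (N + 2),
    McCormick (ent (y.σ r i) v) (ent (y.uOut r i) v) (ent (y.x i) 1)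
      (D.uOutLo (s r) i v) (D.uOutHi i v)
  mc_ζ : ∀ r i, ∀ j ∈ Finset.Icc 2 (N + 1), ∀ v ∈ Finset.Icc j (N + 2),
    McCormick (ent₂ (y.ζ r i) j v) (ent₂ (y.ν r i) j v) (ent (y.x i) (j - 1))
      (D.νLo (s r) i j v) (D.νHi i j v)
  β_first : ∀ r, ent (y.β r) 1 ≥ - D.apt y.a 1 * D.piC 1 1 + ∑ i, ent (y.σ r i) 1
  β_from_one : ∀ r, ∀ v ∈ Finset.Icc 2 (N + 2),
    ∑ j ∈ Finset.Icc 1 v, ent (y.β r) j ≥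
      - D.apt y.a 1 * D.piC 1 v
      + ∑ j ∈ Finset.Icc 2 (min v (N + 1)), (D.apt y.a (j - 1) - D.apt y.a j) * D.piC j v
      + ∑ i, ent (y.σ r i) v
      + ∑ j ∈ Finset.Icc 2 (min v (N + 1)), ∑ i, ∑ i' ∈ Finset.univ.erase i,
          ent₂ (y.φ r i i') j v
      + ∑ j ∈ Finset.Icc 2 (min v (N + 1)), ∑ i, ent₂ (y.ζ r i) j v
  β_from_k : ∀ r, ∀ k ∈ Finset.Icc 2 (N + 1), ∀ v ∈ Finset.Icc k (N + 2),
    ∑ j ∈ Finset.Icc k v, ent (y.β r) j ≥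
      ∑ j ∈ Finset.Icc k (min v (N + 1)), (D.apt y.a (j - 1) - D.apt y.a j) * D.piC j v
      + ∑ j ∈ Finset.Icc k (min v (N + 1)), ∑ i, ent₂ (y.ζ r i) j v
      + ∑ j ∈ Finset.Icc k (min v (N + 1)), ∑ i, ∑ i' ∈ Finset.univ.erase i,
          ent₂ (y.φ r i i') j v
  β_last : ∀ r, ent (y.β r) (N + 2) ≥ 0
  uRet_ge : ∀ r i,
    y.uRet r i ≥ D.lam * (s r).travel i.succ 0 ∧
    y.uRet r i ≥ D.lam * D.hi.travel i.succ 0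
      - y.rho * (D.hi.travel i.succ 0 - (s r).travel i.succ 0)
  uOut_ge : ∀ r i, ∀ v ∈ Finset.Icc 1 (N + 2),
    ent (y.uOut r i) v ≥ (D.piC 1 v + D.lam) * D.lo.travel 0 i.succ
      - y.rho * ((s r).travel 0 i.succ - D.lo.travel 0 i.succ) ∧
    ent (y.uOut r i) v ≥ (D.piC 1 v + D.lam) * (s r).travel 0 i.succ ∧
    ent (y.uOut r i) v ≥ (D.piC 1 v + D.lam) * D.hi.travel 0 i.succ
      - y.rho * (D.hi.travel 0 i.succ - (s r).travel 0 i.succ)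
  uLink_ge : ∀ r i, ∀ i' ∈ Finset.univ.erase i, ∀ j ∈ Finset.Icc 2 (N + 1),
    ∀ v ∈ Finset.Icc j (N + 2),
    ent₂ (y.uLink r i i') j v ≥ (D.piC j v + D.lam) * D.lo.travel i.succ i'.succ
      - y.rho * ((s r).travel i.succ i'.succ - D.lo.travel i.succ i'.succ) ∧
    ent₂ (y.uLink r i i') j v ≥ (D.piC j v + D.lam) * D.hi.travel i.succ i'.succ
      - y.rho * (D.hi.travel i.succ i'.succ - (s r).travel i.succ i'.succ) ∧
    ent₂ (y.uLink r i i') j v ≥ (D.piC j v + D.lam) * (s r).travel i.succ i'.succ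
  ν_ge : ∀ r i, ∀ j ∈ Finset.Icc 2 (N + 1), ∀ v ∈ Finset.Icc j (N + 2),
    ent₂ (y.ν r i) j v ≥ D.piC j v * D.lo.service i
      - y.rho * ((s r).service i - D.lo.service i) ∧
    ent₂ (y.ν r i) j v ≥ D.piC j v * D.hi.service i
      - y.rho * (D.hi.service i - (s r).service i) ∧
    ent₂ (y.ν r i) j v ≥ D.piC j v * (s r).service i

/-- The objective values of the MILP over its feasible set. -/
def milpValues (D : HRASData N) (s : Fin R → Scenario N) (ε : ℝ) : Set ℝ :=
  {z | ∃ y : MILPVars N R, D.MILPFeasible s y ∧ z = D.milpObj ε y}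

/-- The objective values of the MILP over its feasible points with prescribed `(x, a)`. -/
def milpValuesAt (D : HRASData N) (s : Fin R → Scenario N) (ε : ℝ)
    (x : Fin N → Fin N → ℝ) (a : Fin N → ℝ) : Set ℝ :=
  {z | ∃ y : MILPVars N R, D.MILPFeasible s y ∧ y.x = x ∧ y.a = a ∧ z = D.milpObj ε y}

/-- `y` is an optimal solution of the MILP. -/
def IsMILPOptimal (D : HRASData N) (s : Fin R → Scenario N) (ε : ℝ) (y : MILPVars N R) : Prop :=
  D.MILPFeasible s y ∧ D.milpObj ε y ∈ lowerBounds (D.milpValues s ε)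

/-- At the point `y`, every linearising variable equals the product it stands for. -/
def ProductsExact (_D : HRASData N) (y : MILPVars N R) : Prop :=
  (∀ i, ∀ i' ∈ Finset.univ.erase i, ∀ j ∈ Finset.Icc 2 (N + 1),
    ent (y.τ i i') j = ent (y.x i) (j - 1) * ent (y.x i') j) ∧
  (∀ r i, y.ψ r i = y.uRet r i * ent (y.x i) N) ∧
  (∀ r i, ∀ v ∈ Finset.Icc 1 (N + 2),
    ent (y.σ r i) v = ent (y.uOut r i) v * ent (y.x i) 1) ∧
  (∀ r i, ∀ i' ∈ Finset.univ.erase i, ∀ j ∈ Finset.Icc 2 (N + 1), ∀ v ∈ Finset.Icc j (N + 2),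
    ent₂ (y.φ r i i') j v =
      ent₂ (y.uLink r i i') j v * (ent (y.x i) (j - 1) * ent (y.x i') j)) ∧
  (∀ r i, ∀ j ∈ Finset.Icc 2 (N + 1), ∀ v ∈ Finset.Icc j (N + 2),
    ent₂ (y.ζ r i) j v = ent₂ (y.ν r i) j v * ent (y.x i) (j - 1))

/-- `l` and `h` are the smallest and the largest value of `g` on `[0, ∞)`. -/
def TightBounds (g : ℝ → ℝ) (l h : ℝ) : Prop :=
  IsLeast (g '' Set.Ici 0) l ∧ IsGreatest (g '' Set.Ici 0) h

/-- For each `u` and `ν` variable, the bounds used in the McCormick inequalities are the exact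
minimum and maximum of its explicit value over `rho ≥ 0`. -/
def BoundsTight (D : HRASData N) (s : Fin R → Scenario N) : Prop :=
  (∀ r i, TightBounds (D.uRetVal (s r) i) (D.uRetLo (s r) i) (D.uRetHi i)) ∧
  (∀ r i, ∀ v ∈ Finset.Icc 1 (N + 2),
    TightBounds (D.uOutVal (s r) i v) (D.uOutLo (s r) i v) (D.uOutHi i v)) ∧
  (∀ r i, ∀ i' ∈ Finset.univ.erase i, ∀ j ∈ Finset.Icc 2 (N + 1), ∀ v ∈ Finset.Icc j (N + 2),
    TightBounds (D.uLinkVal (s r) i i' j v) (D.uLinkLo (s r) i i' j v) (D.uLinkHi i i' j v)) ∧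
  (∀ r i, ∀ j ∈ Finset.Icc 2 (N + 1), ∀ v ∈ Finset.Icc j (N + 2),
    TightBounds (D.νVal (s r) i j v) (D.νLo (s r) i j v) (D.νHi i j v))

end HRASData

end

/-! ### Intervals and paths -/

/-! Two dualities, one inside the other, reduce everything to longest paths and finitely many
realizations.

Inner duality. For fixed `(x, a, ξ)` the dual of the second stage is a longest-path problem on the
nodes `0, …, N + 2`: the arc `k - 1 → v` has length `∑_{j=k}^v rhs_j π_{j,v}`, and a path cuts the
positions into blocks. Instead of dual solutions the proof uses potentials on the nodes that
dominate all arc lengths (`Dominates`). Feasible waiting and idle times yield such a potential,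
whose total rise is their cost (`dominates_potential`; this is where `c^u_{j+1} ≤ c^u_j + c^w_j`
enters), and the schedule without avoidable idling costs at most the rise of any dominating
potential (`potential_le_of_dominates`). So that schedule is optimal, and the cost is continuous in
`(a, ξ)`.

Penalised supremum. For a sample `m` and a price `ρ`, consider the supremum of `f(ξ) - ρ ‖ξ - m‖₁`
over the support. A path covers each position exactly once, so travel cost and transport cost can be
charged to positions, which turns `π` into `π + λ` for travel times. On a route each coordinate of
`ξ` enters at most one position, so along a fixed path the coordinates are maximised separately,
each at its lower bound, its sample value or its upper bound (`maxVal`). The supremum is therefore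
again a longest path, now with lengths `worstTerm`: `cost_le` bounds it by potentials and
`exists_dominates_corner` attains it at a corner. The variables `β` are increments of a potential,
and McCormick products are exact at binary points.

Outer duality. Integrating the penalised bound against near-optimal couplings bounds every expected
cost by every MILP value (`integral_le_of_mem_ambiguitySet`). Conversely only finitely many choices
of corners matter, so the dual function of `ρ` is a maximum of finitely many affine functions; at
its minimiser two active choices combine into a distribution in the ball that attains the bound
(`exists_saddle`, `exists_milpObj_le_integral`). Optimal decisions exist because there are finitely
many routes, the schedules form a compact set, and the worst-case cost is lower semicontinuous in
the schedule. -/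

theorem sum_Icc_eq_add_left {f : ℕ → ℝ} {k v : ℕ} (h : k ≤ v) :
    ∑ j ∈ Finset.Icc k v, f j = f k + ∑ j ∈ Finset.Icc (k + 1) v, f j := by
  rw [← Finset.insert_Icc_add_one_left_eq_Icc h, Finset.sum_insert (by simp)]

theorem sum_Icc_sub_pred (B : ℕ → ℝ) {k v : ℕ} (h : k ≤ v) :
    ∑ j ∈ Finset.Icc k v, (B j - B (j - 1)) = B v - B (k - 1) := by
  induction v, h using Nat.le_induction with
  | base => simp
  | succ v hv ih => rw [Finset.sum_Icc_succ_top (by omega), ih]; simp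

/-- A potential `B` dominates the arc lengths `∑_{j = k}^v g j v` of the arcs `k - 1 → v`. -/
def Dominates (B : ℕ → ℝ) (g : ℕ → ℕ → ℝ) (n : ℕ) : Prop :=
  ∀ k v, 1 ≤ k → k ≤ v → v ≤ n → ∑ j ∈ Finset.Icc k v, g j v ≤ B v - B (k - 1)

theorem Dominates.mono {B : ℕ → ℝ} {g g' : ℕ → ℕ → ℝ} {n : ℕ} (h : Dominates B g n)
    (hg : ∀ j v, 1 ≤ j → j ≤ v → v ≤ n → g' j v ≤ g j v) : Dominates B g' n :=
  fun k v hk hkv hv => le_trans (Finset.sum_le_sum fun j hj => by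
    rw [Finset.mem_Icc] at hj
    exact hg j v (by omega) (by omega) hv) (h k v hk hkv hv)

/-- Longest-path potentials exist, and each one is the length of a path; `e j` is the endpoint of
the arc of this path that covers `j`. -/
theorem exists_longest_path (g : ℕ → ℕ → ℝ) (n : ℕ) :
    ∃ B : ℕ → ℝ, B 0 = 0 ∧ Dominates B g n ∧ ∀ v ≤ n, ∃ e : ℕ → ℕ,
      (∀ j ∈ Finset.Icc 1 v, j ≤ e j ∧ e j ≤ v) ∧ B v = ∑ j ∈ Finset.Icc 1 v, g j (e j) ∧
      ∀ (g' : ℕ → ℕ → ℝ) (B' : ℕ → ℝ), Dominates B' g' n →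
        ∑ j ∈ Finset.Icc 1 v, g' j (e j) ≤ B' v - B' 0 := by
  induction n with
  | zero =>
    refine ⟨fun _ => 0, rfl, fun k v hk hkv hv => by omega, fun v hv => ⟨id, ?_⟩⟩
    obtain rfl : v = 0 := by omega
    simp
  | succ n ih =>
    obtain ⟨B, hB0, hBd, hBe⟩ := ih
    -- Bellman recursion: `k₀ - 1` is the best tail of the last arc into `n + 1`.
    obtain ⟨k₀, hk₀, hmax⟩ := Finset.exists_max_image (Finset.Icc 1 (n + 1))
      (fun k => B (k - 1) + ∑ j ∈ Finset.Icc k (n + 1), g j (n + 1)) ⟨1, by simp⟩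
    rw [Finset.mem_Icc] at hk₀
    set M := B (k₀ - 1) + ∑ j ∈ Finset.Icc k₀ (n + 1), g j (n + 1) with hM
    have hold : ∀ v ≤ n, Function.update B (n + 1) M v = B v := fun v hv =>
      Function.update_of_ne (by omega) _ _
    have hsplit : ∀ f : ℕ → ℝ, ∑ j ∈ Finset.Icc 1 (n + 1), f j =
        ∑ j ∈ Finset.Icc 1 (k₀ - 1), f j + ∑ j ∈ Finset.Icc k₀ (n + 1), f j := by
      intro f
      rw [← Finset.sum_union]
      · congr 1
        ext j
        simp only [Finset.mem_Icc, Finset.mem_union]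
        omega
      · rw [Finset.disjoint_left]
        intro j
        simp only [Finset.mem_Icc]
        omega
    refine ⟨Function.update B (n + 1) M, by rw [hold 0 (by omega), hB0], ?_, ?_⟩
    · intro k v hk hkv hv
      rcases Nat.lt_or_ge n v with h | h
      · obtain rfl : v = n + 1 := by omega
        rw [Function.update_self, hold (k - 1) (by omega)]
        have := hmax k (by simp; omega)
        linarith
      · rw [hold v h, hold (k - 1) (by omega)]
        exact hBd k v hk hkv h
    · intro v hv
      rcases Nat.lt_or_ge n v with h | h
      · obtain rfl : v = n + 1 := by omega
        obtain ⟨e, he, hBv, hopt⟩ := hBe (k₀ - 1) (by omega)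
        have h1 : ∀ f : ℕ → ℕ → ℝ,
            ∑ j ∈ Finset.Icc 1 (n + 1), f j (if j < k₀ then e j else n + 1) =
            ∑ j ∈ Finset.Icc 1 (k₀ - 1), f j (e j) + ∑ j ∈ Finset.Icc k₀ (n + 1), f j (n + 1) := by
          intro f
          rw [hsplit]
          congr 1
          · refine Finset.sum_congr rfl fun j hj => ?_
            rw [Finset.mem_Icc] at hj
            rw [if_pos (by omega)]
          · refine Finset.sum_congr rfl fun j hj => ?_
            rw [Finset.mem_Icc] at hj
            rw [if_neg (by omega)]
        -- The optimal path to `k₀ - 1`, followed by the arc `k₀ - 1 → n + 1`.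
        refine ⟨fun j => if j < k₀ then e j else n + 1, ?_, ?_, ?_⟩
        · intro j hj
          rw [Finset.mem_Icc] at hj
          simp only
          split_ifs with hjk
          · have := he j (by simp; omega)
            omega
          · omega
        · rw [h1, Function.update_self, hM, hBv]
        · intro g' B' hB'
          rw [h1]
          have h2 := hopt g' B' fun k v hk hkv hv => hB' k v hk hkv (by omega)
          have h3 := hB' k₀ (n + 1) (by omega) (by omega) le_rfl
          linarith
      · obtain ⟨e, he, hBv, hopt⟩ := hBe v h
        exact ⟨e, he, by rw [hold v h, hBv], fun g' B' hB' =>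
          hopt g' B' fun k v hk hkv hv => hB' k v hk hkv (by omega)⟩

/-! ### Counting from one -/

theorem ent_of_mem {n : ℕ} (f : ℕ → ℝ) {j : ℕ} (h1 : 1 ≤ j) (h2 : j ≤ n) :
    ent (fun i : Fin n => f (i + 1)) j = f j := by
  simp only [ent, h1, h2, and_self, dif_pos]
  congr 1
  omega

theorem ent₂_of_mem {m n : ℕ} (f : ℕ → ℕ → ℝ) {j v : ℕ} (h1 : 1 ≤ j) (h2 : j ≤ m) (h3 : 1 ≤ v)
    (h4 : v ≤ n) :
    ent₂ (fun (j' : Fin m) (v' : Fin n) => f (j' + 1) (v' + 1)) j v = f j v := by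
  rw [ent₂, ent_of_mem (fun j => ent (fun v' : Fin n => f j (v' + 1)) v) h1 h2,
    ent_of_mem _ h3 h4]

theorem ent_eq_zero {n : ℕ} (f : Fin n → ℝ) {j : ℕ} (h : ¬ (1 ≤ j ∧ j ≤ n)) : ent f j = 0 :=
  dif_neg h

theorem ent_nonneg {n : ℕ} {f : Fin n → ℝ} (hf : ∀ j, 0 ≤ f j) (j : ℕ) : 0 ≤ ent f j := by
  unfold ent
  split_ifs
  · exact hf _
  · exact le_rfl

theorem continuous_ent {n : ℕ} (j : ℕ) : Continuous fun f : Fin n → ℝ => ent f j := by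
  unfold ent
  split_ifs
  · exact continuous_apply _
  · exact continuous_const

/-! ### Dual weights -/

namespace HRASData

variable {N R : ℕ} (D : HRASData N)

/-- The sign and monotonicity conditions on the unit costs, in terms of the extended costs. -/
structure CostsOk : Prop where
  cw_nonneg : ∀ j, 0 ≤ D.cwExt j
  cu_nonneg : ∀ j, 0 ≤ D.cuExt j
  cu_succ_le : ∀ j, 1 ≤ j → D.cuExt (j + 1) ≤ D.cuExt j + D.cwExt j

variable {D}

theorem costsOk (hcw : ∀ j, 0 ≤ D.cw j) (hcu : ∀ j, 0 ≤ D.cu j) (hco : 0 ≤ D.co)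
    (hmono : ∀ j j' : Fin N, (j' : ℕ) = j + 1 → D.cu j' ≤ D.cu j + D.cw j) : D.CostsOk := by
  have h1 : ∀ j, 0 ≤ D.cwExt j := fun j => by
    unfold cwExt
    split_ifs
    · exact hco
    · exact ent_nonneg hcw j
  have h2 : ∀ j, 0 ≤ D.cuExt j := fun j => ent_nonneg hcu j
  refine ⟨h1, h2, fun j hj => ?_⟩
  rcases Nat.lt_or_ge j N with h | h
  · have h3 : D.cwExt j = D.cw ⟨j - 1, by omega⟩ := by
      rw [cwExt, if_neg (by omega), ent, dif_pos ⟨hj, by omega⟩]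
    have h4 : D.cuExt j = D.cu ⟨j - 1, by omega⟩ := by
      rw [cuExt, ent, dif_pos ⟨hj, by omega⟩]
    have h5 : D.cuExt (j + 1) = D.cu ⟨j, h⟩ := by
      rw [cuExt, ent, dif_pos ⟨by omega, by omega⟩]; rfl
    rw [h3, h4, h5]
    exact hmono _ _ (by simp; omega)
  · have : D.cuExt (j + 1) = 0 := ent_eq_zero _ (by omega)
    rw [this]
    exact add_nonneg (h2 j) (h1 j)

theorem piC_self (v : ℕ) : D.piC v v = - D.cuExt v := by simp [piC]

theorem piC_last : D.piC (N + 2) (N + 2) = 0 := by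
  rw [piC_self, cuExt, ent_eq_zero _ (by omega), neg_zero]

theorem piC_eq_add {k v : ℕ} (h : k < v) : D.piC k v = D.cwExt k + D.piC (k + 1) v := by
  rw [piC, piC, Finset.sum_eq_sum_Ico_succ_bot h]
  ring

/-- Raising `v` by one changes `π_{j,v}` by `c^u_v + c^w_v - c^u_{v+1} ≥ 0`, and `π_{j,j} = -c^u_j`.
In dual terms the weights `π` respect the sign constraint belonging to `u_j`. -/
theorem CostsOk.neg_cuExt_le_piC (h : D.CostsOk) {j v : ℕ} (hj : 1 ≤ j) (hv : j ≤ v) :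
    - D.cuExt j ≤ D.piC j v := by
  induction v, hv using Nat.le_induction with
  | base => rw [piC_self]
  | succ v hv ih =>
    have := h.cu_succ_le v (by omega)
    rw [piC, Finset.sum_Ico_succ_top hv]
    rw [piC] at ih
    linarith

/-- The cost accumulated by waiting times `w` and idle times `u` up to position `v`, less the
charge `c^u_v w_v`. -/
def potential (D : HRASData N) (w u : ℕ → ℝ) (v : ℕ) : ℝ :=
  ∑ j ∈ Finset.range v, D.cwExt j * w j + ∑ j ∈ Finset.range (v + 1), D.cuExt j * u j
    - D.cuExt v * w v

/-- Summation by parts: inside the block `w j` receives `π_{j,v} - π_{j+1,v} = c^w_j`, and at the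
end `w v` receives `-c^u_v`. Compared with the increment of the potential, the two remaining sums
are the complementary slackness defects: waiting carried into the block, and idling inside it. -/
theorem sum_mul_piC (w u : ℕ → ℝ) {k v : ℕ} (hk : 1 ≤ k) (hv : k ≤ v) :
    ∑ j ∈ Finset.Icc k v, (w j - w (j - 1) - u j) * D.piC j v =
      D.potential w u v - D.potential w u (k - 1)
      - (D.cwExt (k - 1) + D.cuExt (k - 1) + D.piC k v) * w (k - 1)
      - ∑ j ∈ Finset.Icc k v, (D.cuExt j + D.piC j v) * u j := by
  have hpot : ∀ m, D.potential w u (m + 1) = D.potential w u m + D.cwExt m * w m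
      + D.cuExt (m + 1) * u (m + 1) - D.cuExt (m + 1) * w (m + 1) + D.cuExt m * w m := by
    intro m
    simp only [potential, Finset.sum_range_succ]
    ring
  induction hv using Nat.decreasingInduction with
  | self =>
    obtain ⟨m, rfl⟩ : ∃ m, v = m + 1 := ⟨v - 1, by omega⟩
    simp only [Finset.Icc_self, Finset.sum_singleton, piC_self, Nat.add_sub_cancel, hpot]
    ring
  | of_succ k hkv ih =>
    obtain ⟨m, rfl⟩ : ∃ m, k = m + 1 := ⟨k - 1, by omega⟩
    specialize ih (by omega)
    rw [sum_Icc_eq_add_left (by omega), ih, sum_Icc_eq_add_left (by omega : m + 1 ≤ v)]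
    simp only [Nat.add_sub_cancel, hpot]
    rw [piC_eq_add (by omega : m + 1 < v)]
    ring

/-- Weak duality for the second stage: both defect terms of `sum_mul_piC` are nonnegative. At the
first position the carried waiting time is zero, so no condition relating the costs at `0` and `1`
is needed. -/
theorem CostsOk.dominates_potential (h : D.CostsOk) {w u : ℕ → ℝ} (hw : ∀ j, 0 ≤ w j)
    (hu : ∀ j, 0 ≤ u j) (hw0 : w 0 = 0) (n : ℕ) :
    Dominates (D.potential w u) (fun j v => (w j - w (j - 1) - u j) * D.piC j v) n := by
  intro k v hk hkv _
  rw [sum_mul_piC w u hk hkv]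
  have h1 : 0 ≤ ∑ j ∈ Finset.Icc k v, (D.cuExt j + D.piC j v) * u j := by
    refine Finset.sum_nonneg fun j hj => ?_
    rw [Finset.mem_Icc] at hj
    have := h.neg_cuExt_le_piC (by omega : 1 ≤ j) hj.2
    exact mul_nonneg (by linarith) (hu j)
  have h2 : 0 ≤ (D.cwExt (k - 1) + D.cuExt (k - 1) + D.piC k v) * w (k - 1) := by
    obtain ⟨m, rfl⟩ : ∃ m, k = m + 1 := ⟨k - 1, by omega⟩
    rw [Nat.add_sub_cancel]
    rcases Nat.eq_zero_or_pos m with rfl | hm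
    · rw [hw0, mul_zero]
    · have := h.neg_cuExt_le_piC hk hkv
      have := h.cu_succ_le m hm
      exact mul_nonneg (by linarith) (hw m)
  linarith

/-- Complementary waiting and idle times cost no more than a dominating potential. -/
theorem potential_le_of_dominates {w u : ℕ → ℝ} (hw0 : w 0 = 0)
    (hcomp : ∀ j, 1 ≤ j → u j = 0 ∨ w j = 0) {n : ℕ} (hn : 1 ≤ n) {B : ℕ → ℝ}
    (hB : Dominates B (fun j v => (w j - w (j - 1) - u j) * D.piC j v) n) :
    D.potential w u n - D.potential w u 0 ≤ B n - B 0 := by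
  -- A block with no waiting carried in and no idling before its end has zero defect; idling at the
  -- end `v` is free because `c^u_v + π_{v,v} = 0`.
  have close : ∀ k v, 1 ≤ k → k ≤ v → v ≤ n → w (k - 1) = 0 →
      (∀ j, k ≤ j → j < v → u j = 0) →
      D.potential w u (k - 1) - D.potential w u 0 ≤ B (k - 1) - B 0 →
      D.potential w u v - D.potential w u 0 ≤ B v - B 0 := by
    intro k v hk hkv hv hwk hu hle
    have h1 := hB k v hk hkv hv
    rw [sum_mul_piC w u hk hkv, hwk] at h1
    have h2 : ∑ j ∈ Finset.Icc k v, (D.cuExt j + D.piC j v) * u j = 0 := by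
      refine Finset.sum_eq_zero fun j hj => ?_
      rw [Finset.mem_Icc] at hj
      rcases Nat.lt_or_ge j v with h | h
      · rw [hu j hj.1 h, mul_zero]
      · obtain rfl : j = v := by omega
        rw [piC_self]
        ring
    linarith
  -- The block still open after `v` starts at `k`. By complementarity, either `v + 1` has no idling
  -- and the block continues, or it has no waiting and the block closes there.
  have inv : ∀ v < n, ∃ k, 1 ≤ k ∧ k ≤ v + 1 ∧ w (k - 1) = 0 ∧ (∀ j, k ≤ j → j ≤ v → u j = 0) ∧
      D.potential w u (k - 1) - D.potential w u 0 ≤ B (k - 1) - B 0 := by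
    intro v
    induction v with
    | zero => exact fun _ => ⟨1, le_rfl, le_rfl, hw0, fun j _ _ => by omega, by simp⟩
    | succ v ih =>
      intro hv
      obtain ⟨k, hk, hkv, hwk, hu, hle⟩ := ih (by omega)
      rcases hcomp (v + 1) (by omega) with h | h
      · refine ⟨k, hk, by omega, hwk, fun j hj hjv => ?_, hle⟩
        rcases Nat.lt_or_ge v j with h' | h'
        · obtain rfl : j = v + 1 := by omega
          exact h
        · exact hu j hj h'
      · exact ⟨v + 2, by omega, le_rfl, h, fun j _ _ => by omega,
          close k (v + 1) hk (by omega) (by omega) hwk (fun j hj hjv => hu j hj (by omega)) hle⟩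
  obtain ⟨k, hk, hkv, hwk, hu, hle⟩ := inv (n - 1) (by omega)
  exact close k n hk (by omega) le_rfl hwk (fun j hj hjv => hu j hj (by omega)) hle

end HRASData

/-! ### The second-stage linear program -/

/-- Waiting times of the schedule without avoidable idling, when position `j` is late by `b j`. -/
noncomputable def greedyWait (b : ℕ → ℝ) : ℕ → ℝ
  | 0 => 0
  | j + 1 => max 0 (greedyWait b j + b (j + 1))

/-- Idle times that belong to `greedyWait`. -/
noncomputable def greedyIdle (b : ℕ → ℝ) (j : ℕ) : ℝ := max 0 (-(greedyWait b (j - 1) + b j))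

theorem greedyWait_nonneg (b : ℕ → ℝ) (j : ℕ) : 0 ≤ greedyWait b j := by
  cases j
  · exact le_rfl
  · exact le_max_left _ _

theorem greedyIdle_nonneg (b : ℕ → ℝ) (j : ℕ) : 0 ≤ greedyIdle b j := le_max_left _ _

theorem greedyWait_sub (b : ℕ → ℝ) {j : ℕ} (hj : 1 ≤ j) :
    greedyWait b j - greedyWait b (j - 1) - greedyIdle b j = b j := by
  obtain ⟨m, rfl⟩ : ∃ m, j = m + 1 := ⟨j - 1, by omega⟩
  rw [greedyIdle, Nat.add_sub_cancel, greedyWait]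
  rcases le_total 0 (greedyWait b m + b (m + 1)) with h | h
  · rw [max_eq_right h, max_eq_left (by linarith)]; ring
  · rw [max_eq_left h, max_eq_right (by linarith)]; ring

theorem greedy_complementary (b : ℕ → ℝ) {j : ℕ} (hj : 1 ≤ j) :
    greedyIdle b j = 0 ∨ greedyWait b j = 0 := by
  obtain ⟨m, rfl⟩ : ∃ m, j = m + 1 := ⟨j - 1, by omega⟩
  rw [greedyIdle, Nat.add_sub_cancel, greedyWait]
  rcases le_total 0 (greedyWait b m + b (m + 1)) with h | h
  · exact Or.inl (max_eq_left (by linarith))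
  · exact Or.inr (max_eq_left h)

theorem continuous_greedyWait {X : Type*} [TopologicalSpace X] {b : X → ℕ → ℝ}
    (hb : ∀ j, Continuous fun p => b p j) (j : ℕ) : Continuous fun p => greedyWait (b p) j := by
  induction j with
  | zero => exact continuous_const
  | succ j ih => exact continuous_const.max (ih.add (hb _))

theorem continuous_greedyIdle {X : Type*} [TopologicalSpace X] {b : X → ℕ → ℝ}
    (hb : ∀ j, Continuous fun p => b p j) (j : ℕ) : Continuous fun p => greedyIdle (b p) j :=
  continuous_const.max ((continuous_greedyWait hb _).add (hb _)).neg

namespace HRASData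

variable {N R : ℕ} {D : HRASData N}

/-- Right-hand side of the `j`-th constraint of the second-stage linear program. -/
def rhs (D : HRASData N) (x : Fin N → Fin N → ℝ) (a : Fin N → ℝ) (ξ : Scenario N) (j : ℕ) : ℝ :=
  if j = 1 then ∑ i, ξ.travel 0 i.succ * ent (x i) 1 - D.apt a 1
  else D.apt a (j - 1) - D.apt a j + ∑ i, ξ.service i * ent (x i) (j - 1)
    + ∑ i, ∑ i' ∈ Finset.univ.erase i,
        ξ.travel i.succ i'.succ * ent (x i) (j - 1) * ent (x i') j

/-- The defaults of `ent` merge the three kinds of constraints into one recursion: `w_0 = 0` handles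
the first, and `x_{i,N+1} = 0` removes the travel term from the last. -/
theorem secondStageFeasible_iff {x : Fin N → Fin N → ℝ} {a : Fin N → ℝ} {ξ : Scenario N}
    {u w : Fin (N + 1) → ℝ} (hN : 0 < N) :
    D.SecondStageFeasible x a ξ u w ↔
      (∀ j ∈ Finset.Icc 1 (N + 1), ent w j - ent w (j - 1) - ent u j = D.rhs x a ξ j) ∧
      ∀ j, 0 ≤ w j ∧ 0 ≤ u j := by
  have h1 : ent w 1 - ent w (1 - 1) - ent u 1 = ent w 1 - ent u 1 := by
    rw [ent_eq_zero w (j := 1 - 1) (by omega), sub_zero]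
  have h2 : D.rhs x a ξ (N + 1) = D.apt a N - D.apt a (N + 1) + ∑ i, ξ.service i * ent (x i) N := by
    rw [rhs, if_neg (by omega), Nat.add_sub_cancel]
    have : ∀ i, ent (x i) (N + 1) = 0 := fun i => ent_eq_zero _ (by omega)
    simp [this]
  have h3 : ∀ j, 2 ≤ j → D.rhs x a ξ j = D.apt a (j - 1) - D.apt a j
      + ∑ i, ξ.service i * ent (x i) (j - 1) + ∑ i, ∑ i' ∈ Finset.univ.erase i,
        ξ.travel i.succ i'.succ * ent (x i) (j - 1) * ent (x i') j := fun j hj => by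
    rw [rhs, if_neg (by omega)]
  have h4 : D.rhs x a ξ 1 = ∑ i, ξ.travel 0 i.succ * ent (x i) 1 - D.apt a 1 := if_pos rfl
  constructor
  · rintro ⟨ha, hb, hc, hd⟩
    refine ⟨fun j hj => ?_, hd⟩
    rw [Finset.mem_Icc] at hj
    rcases Nat.lt_or_ge j 2 with h | h
    · obtain rfl : j = 1 := by omega
      rw [h1, h4, ha]
    · rcases Nat.lt_or_ge N j with h' | h'
      · obtain rfl : j = N + 1 := by omega
        rw [h2, Nat.add_sub_cancel, hc]
      · rw [h3 j h, hb j (by simp; omega)]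
  · rintro ⟨ha, hd⟩
    refine ⟨?_, fun j hj => ?_, ?_, hd⟩
    · rw [← h1, ha 1 (by simp), h4]
    · rw [Finset.mem_Icc] at hj
      rw [ha j (by simp; omega), h3 j hj.1]
    · have := ha (N + 1) (by simp)
      rwa [h2, Nat.add_sub_cancel] at this

theorem potential_zero (w u : ℕ → ℝ) : D.potential w u 0 = 0 := by
  simp [potential, cuExt, ent_eq_zero]

/-- The dummy position `N + 2` makes the potential a genuine cost: the charge `c^u_v w_v` vanishes
there, while the sum of waiting costs already includes overtime. -/
theorem potential_last (w u : ℕ → ℝ) : D.potential w u (N + 2) =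
    ∑ j ∈ Finset.Icc 1 N, (ent D.cw j * w j + ent D.cu j * u j) + D.co * w (N + 1) := by
  have hcu : ∀ j, ¬ (1 ≤ j ∧ j ≤ N) → D.cuExt j = 0 := fun j hj => ent_eq_zero _ hj
  have h0 : D.cwExt 0 = 0 := by rw [cwExt, if_neg (by omega), ent_eq_zero _ (by omega)]
  have h1 : D.cwExt (N + 1) = D.co := if_pos rfl
  have hr : ∀ f : ℕ → ℝ, f 0 = 0 → ∑ j ∈ Finset.range (N + 1), f j = ∑ j ∈ Finset.Icc 1 N, f j := by
    intro f hf
    rw [Finset.sum_range_succ', hf, add_zero, Finset.range_eq_Ico, Finset.sum_Ico_add' f 0 N 1]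
    rfl
  rw [potential, Finset.sum_range_succ, Finset.sum_range_succ _ (N + 2),
    Finset.sum_range_succ _ (N + 1), hr _ (by rw [h0, zero_mul]),
    hr _ (by rw [hcu 0 (by omega), zero_mul]), hcu (N + 1) (by omega), hcu (N + 2) (by omega), h1,
    Finset.sum_add_distrib]
  have h2 : ∑ j ∈ Finset.Icc 1 N, D.cwExt j * w j = ∑ j ∈ Finset.Icc 1 N, ent D.cw j * w j :=
    Finset.sum_congr rfl fun j hj => by
      rw [Finset.mem_Icc] at hj
      rw [cwExt, if_neg (by omega)]
  rw [h2]
  simp only [cuExt]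
  ring

theorem secondStageObj_eq (x : Fin N → Fin N → ℝ) (ξ : Scenario N) (u w : Fin (N + 1) → ℝ) :
    D.secondStageObj x ξ u w =
      D.potential (ent w) (ent u) (N + 2) + D.lam * travelTotal x ξ := by
  rw [potential_last, secondStageObj]

/-- At `j = N + 2` there is no constraint and `rhs` takes a meaningless value, but the only weight
there is `π_{N+2,N+2} = 0`. -/
theorem sub_mul_piC_eq_rhs {x : Fin N → Fin N → ℝ} {a : Fin N → ℝ} {ξ : Scenario N}
    {w u : ℕ → ℝ}
    (h : ∀ j ∈ Finset.Icc 1 (N + 1), w j - w (j - 1) - u j = D.rhs x a ξ j)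
    {j v : ℕ} (hj : 1 ≤ j) (hjv : j ≤ v) (hv : v ≤ N + 2) :
    (w j - w (j - 1) - u j) * D.piC j v = D.rhs x a ξ j * D.piC j v := by
  rcases Nat.lt_or_ge (N + 1) j with h' | h'
  · obtain rfl : j = N + 2 := by omega
    obtain rfl : v = N + 2 := by omega
    rw [piC_last, mul_zero, mul_zero]
  · rw [h j (by simp; omega)]

/-- Cost of the schedule without avoidable idling. -/
noncomputable def greedyCost (D : HRASData N) (x : Fin N → Fin N → ℝ) (a : Fin N → ℝ)
    (ξ : Scenario N) : ℝ :=
  D.potential (greedyWait (D.rhs x a ξ)) (greedyIdle (D.rhs x a ξ)) (N + 2)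
    + D.lam * travelTotal x ξ

theorem greedyCost_mem (hN : 0 < N) (x : Fin N → Fin N → ℝ) (a : Fin N → ℝ) (ξ : Scenario N) :
    D.greedyCost x a ξ ∈ D.secondStageValues x a ξ := by
  set b := D.rhs x a ξ with hb
  have hw : ∀ j, j ≤ N + 1 → ent (fun j : Fin (N + 1) => greedyWait b (j + 1)) j = greedyWait b j := by
    intro j hj
    rcases Nat.eq_zero_or_pos j with rfl | h
    · rw [ent_eq_zero _ (by omega)]; rfl
    · exact ent_of_mem _ h hj
  have hu : ∀ j, 1 ≤ j → j ≤ N + 1 →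
      ent (fun j : Fin (N + 1) => greedyIdle b (j + 1)) j = greedyIdle b j :=
    fun j h1 h2 => ent_of_mem _ h1 h2
  refine ⟨fun j => greedyIdle b (j + 1), fun j => greedyWait b (j + 1), ?_, ?_⟩
  · rw [secondStageFeasible_iff hN]
    refine ⟨fun j hj => ?_, fun j => ⟨greedyWait_nonneg _ _, greedyIdle_nonneg _ _⟩⟩
    rw [Finset.mem_Icc] at hj
    rw [hw j hj.2, hw (j - 1) (by omega), hu j hj.1 hj.2, greedyWait_sub b hj.1]
  · rw [secondStageObj_eq, greedyCost, potential_last, potential_last, hw (N + 1) le_rfl]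
    congr 2
    refine Finset.sum_congr rfl fun j hj => ?_
    rw [Finset.mem_Icc] at hj
    rw [hw j (by omega), hu j hj.1 (by omega)]

theorem greedyCost_le_of_dominates {x : Fin N → Fin N → ℝ} {a : Fin N → ℝ} {ξ : Scenario N}
    {B : ℕ → ℝ} (hB : Dominates B (fun j v => D.rhs x a ξ j * D.piC j v) (N + 2)) :
    D.greedyCost x a ξ ≤ B (N + 2) - B 0 + D.lam * travelTotal x ξ := by
  have := potential_le_of_dominates (D := D) (w := greedyWait (D.rhs x a ξ)) (u := greedyIdle _)
    rfl (fun j hj => greedy_complementary (D.rhs x a ξ) hj) (by omega)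
    (hB.mono fun j v hj hjv hv => (sub_mul_piC_eq_rhs
      (fun j hj => greedyWait_sub _ (Finset.mem_Icc.1 hj).1) hj hjv hv).le)
  rw [potential_zero, sub_zero] at this
  rw [greedyCost]
  linarith

theorem CostsOk.exists_dominates (hN : 0 < N) (h : D.CostsOk) {x : Fin N → Fin N → ℝ}
    {a : Fin N → ℝ} {ξ : Scenario N} {z : ℝ} (hz : z ∈ D.secondStageValues x a ξ) :
    ∃ B : ℕ → ℝ, Dominates B (fun j v => D.rhs x a ξ j * D.piC j v) (N + 2) ∧
      z = B (N + 2) - B 0 + D.lam * travelTotal x ξ := by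
  obtain ⟨u, w, hf, rfl⟩ := hz
  rw [secondStageFeasible_iff hN] at hf
  refine ⟨D.potential (ent w) (ent u), ?_, ?_⟩
  · refine (h.dominates_potential (ent_nonneg fun j => (hf.2 j).1)
      (ent_nonneg fun j => (hf.2 j).2) (ent_eq_zero _ (by omega)) _).mono fun j v hj hjv hv => ?_
    exact (sub_mul_piC_eq_rhs hf.1 hj hjv hv).ge
  · rw [secondStageObj_eq, potential_zero, sub_zero]

theorem CostsOk.isLeast_greedyCost (hN : 0 < N) (h : D.CostsOk) (x : Fin N → Fin N → ℝ)
    (a : Fin N → ℝ) (ξ : Scenario N) :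
    IsLeast (D.secondStageValues x a ξ) (D.greedyCost x a ξ) := by
  refine ⟨greedyCost_mem hN x a ξ, fun z hz => ?_⟩
  obtain ⟨B, hB, rfl⟩ := h.exists_dominates hN hz
  exact greedyCost_le_of_dominates hB

theorem CostsOk.cost_eq (hN : 0 < N) (h : D.CostsOk) (x : Fin N → Fin N → ℝ)
    (a : Fin N → ℝ) (ξ : Scenario N) : D.cost x a ξ = D.greedyCost x a ξ :=
  (h.isLeast_greedyCost hN x a ξ).csInf_eq

/-! ### Joint continuity of the second-stage cost in schedule and realization. -/

theorem continuous_travel (i i' : Fin (N + 1)) : Continuous fun ξ : Scenario N => ξ.travel i i' := by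
  unfold Scenario.travel
  split_ifs
  · exact (continuous_apply _).comp continuous_fst
  · exact continuous_const

theorem continuous_service (i : Fin N) : Continuous fun ξ : Scenario N => ξ.service i :=
  (continuous_apply _).comp continuous_snd

theorem continuous_apt (j : ℕ) : Continuous fun a : Fin N → ℝ => D.apt a j := by
  unfold apt
  split_ifs
  · exact continuous_const
  · exact continuous_ent j

theorem continuous_rhs (x : Fin N → Fin N → ℝ) (j : ℕ) :
    Continuous fun p : (Fin N → ℝ) × Scenario N => D.rhs x p.1 p.2 j := by
  have ht := fun i i' => (continuous_travel (N := N) i i').comp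
    (continuous_snd (X := Fin N → ℝ) (Y := Scenario N))
  have hd := fun i => (continuous_service (N := N) i).comp
    (continuous_snd (X := Fin N → ℝ) (Y := Scenario N))
  have ha := fun j => (continuous_apt (D := D) j).comp
    (continuous_fst (X := Fin N → ℝ) (Y := Scenario N))
  simp only [Function.comp_def] at ht hd ha
  unfold rhs
  split_ifs <;> fun_prop

theorem continuous_greedyCost (x : Fin N → Fin N → ℝ) :
    Continuous fun p : (Fin N → ℝ) × Scenario N => D.greedyCost x p.1 p.2 := by
  have ht := fun i i' => (continuous_travel (N := N) i i').comp
    (continuous_snd (X := Fin N → ℝ) (Y := Scenario N))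
  have hw := continuous_greedyWait (continuous_rhs (D := D) x)
  have hu := continuous_greedyIdle (continuous_rhs (D := D) x)
  simp only [Function.comp_def] at ht
  unfold greedyCost potential travelTotal
  fun_prop

theorem CostsOk.continuous_cost (hN : 0 < N) (h : D.CostsOk) (x : Fin N → Fin N → ℝ) :
    Continuous fun p : (Fin N → ℝ) × Scenario N => D.cost x p.1 p.2 := by
  simp only [h.cost_eq hN]
  exact continuous_greedyCost x

end HRASData

/-! ### Elementary inequalities -/

theorem mcCormick_iff {z u b l h : ℝ} (hb : b = 0 ∨ b = 1) :
    McCormick z u b l h ↔ z = u * b ∧ l ≤ u ∧ u ≤ h := by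
  unfold McCormick
  rcases hb with rfl | rfl
  · constructor
    · rintro ⟨h1, h2, h3, h4⟩
      exact ⟨by linarith, by linarith, by linarith⟩
    · rintro ⟨h1, h2, h3⟩
      exact ⟨by linarith, by linarith, by linarith, by linarith⟩
  · constructor
    · rintro ⟨h1, h2, h3, h4⟩
      exact ⟨by linarith, by linarith, by linarith⟩
    · rintro ⟨h1, h2, h3⟩
      exact ⟨by linarith, by linarith, by linarith, by linarith⟩

namespace HRASData

/-- The left side is affine in `t` on each side of `m`, so its maximum over `[l, h]` is reached at
`l`, `m` or `h`. The case split is on the sign of the slope `c + ρ` or `c - ρ`. -/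
theorem sub_mul_abs_le_maxVal {c l m h t ρ : ℝ} (hlt : l ≤ t) (hth : t ≤ h) :
    c * t - ρ * |t - m| ≤ maxVal c l m h ρ := by
  unfold maxVal
  rcases le_total t m with htm | htm
  · rw [abs_of_nonpos (by linarith)]
    refine le_trans ?_ (le_max_left _ _)
    rcases le_total 0 (c + ρ) with hc | hc
    · refine le_trans ?_ (le_max_right _ _)
      nlinarith
    · refine le_trans ?_ (le_max_left _ _)
      nlinarith
  · rw [abs_of_nonneg (by linarith)]
    rcases le_total 0 (c - ρ) with hc | hc
    · refine le_trans ?_ (le_max_right _ _)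
      nlinarith
    · refine le_trans ?_ (le_max_left _ _)
      refine le_trans ?_ (le_max_right _ _)
      nlinarith

theorem exists_maxVal_eq {c l m h ρ : ℝ} (hlm : l ≤ m) (hmh : m ≤ h) :
    ∃ t, (t = l ∨ t = m ∨ t = h) ∧ maxVal c l m h ρ = c * t - ρ * |t - m| := by
  unfold maxVal
  rcases max_choice (max (c * l - ρ * (m - l)) (c * m)) (c * h - ρ * (h - m)) with h1 | h1
  · rw [h1]
    rcases max_choice (c * l - ρ * (m - l)) (c * m) with h2 | h2
    · exact ⟨l, Or.inl rfl, by rw [h2, abs_of_nonpos (by linarith)]; ring⟩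
    · exact ⟨m, Or.inr (Or.inl rfl), by rw [h2]; simp⟩
  · exact ⟨h, Or.inr (Or.inr rfl), by rw [h1, abs_of_nonneg (by linarith)]⟩

theorem mul_le_maxVal (c l m h ρ : ℝ) : c * m ≤ maxVal c l m h ρ :=
  (le_max_right _ _).trans (le_max_left _ _)

theorem maxVal_le {c l m h ρ : ℝ} (hρ : 0 ≤ ρ) (hlm : l ≤ m) (hmh : m ≤ h) :
    maxVal c l m h ρ ≤ max (c * l) (c * h) := by
  refine max_le (max_le ?_ ?_) ?_
  · exact le_trans (by nlinarith) (le_max_left _ _)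
  · rcases le_total 0 c with hc | hc
    · exact le_trans (by nlinarith) (le_max_right _ _)
    · exact le_trans (by nlinarith) (le_max_left _ _)
  · exact le_trans (by nlinarith) (le_max_right _ _)

/-- At price `ρ = |c|` no move away from `m` pays, which gives the minimum; at `ρ = 0` moves are
free, which gives the maximum. -/
theorem tightBounds_maxVal {c l m h : ℝ} (hlm : l ≤ m) (hmh : m ≤ h) :
    TightBounds (maxVal c l m h) (c * m) (max (c * l) (c * h)) := by
  refine ⟨⟨⟨|c|, abs_nonneg c, ?_⟩, ?_⟩, ⟨⟨0, Set.mem_Ici.2 le_rfl, ?_⟩, ?_⟩⟩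
  · refine le_antisymm (max_le (max_le ?_ le_rfl) ?_) (mul_le_maxVal _ _ _ _ _)
    · nlinarith [neg_abs_le c]
    · nlinarith [le_abs_self c]
  · rintro _ ⟨ρ, _, rfl⟩
    exact mul_le_maxVal _ _ _ _ _
  · refine le_antisymm (maxVal_le le_rfl hlm hmh) (max_le ?_ ?_)
    · exact le_trans (by simp) ((le_max_left (c * l - 0 * (m - l)) (c * m)).trans (le_max_left _ _))
    · exact le_trans (by simp) (le_max_right _ (c * h - 0 * (h - m)))
  · rintro _ ⟨ρ, hρ, rfl⟩
    exact maxVal_le hρ hlm hmh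

/-- The worst value of a coordinate that enters at most one position `j`, as prescribed by the
indicators `X j`. -/
theorem exists_worst_coordinate (J : Finset ℕ) (X : ℕ → ℝ) (hX : ∀ j, X j = 0 ∨ X j = 1)
    (huniq : ∀ j j', X j = 1 → X j' = 1 → j = j') (c : ℕ → ℝ) {l m h : ℝ} (hlm : l ≤ m)
    (hmh : m ≤ h) (ρ : ℝ) :
    ∃ t, (t = l ∨ t = m ∨ t = h) ∧
      (∀ j ∈ J, maxVal (c j) l m h ρ * X j ≤ (c j * t - ρ * |t - m|) * X j) ∧
      |t - m| ≤ ∑ j ∈ J, X j * |t - m| := by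
  by_cases hj : ∃ j ∈ J, X j = 1
  · obtain ⟨j₀, hj₀, h1⟩ := hj
    obtain ⟨t, ht, heq⟩ := exists_maxVal_eq (c := c j₀) (ρ := ρ) hlm hmh
    refine ⟨t, ht, fun j _ => ?_, ?_⟩
    · rcases hX j with h' | h'
      · simp [h']
      · obtain rfl := huniq j j₀ h' h1
        rw [heq]
    · refine le_trans ?_ (Finset.single_le_sum (f := fun j => X j * |t - m|) (fun j _ => ?_) hj₀)
      · simp [h1]
      · rcases hX j with h' | h' <;> simp [h']
  · push Not at hj
    have h0 : ∀ j ∈ J, X j = 0 := fun j h => (hX j).resolve_right (hj j h)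
    -- A coordinate used by no position stays at the sample value, so it adds no transport cost.
    refine ⟨m, Or.inr (Or.inl rfl), fun j h => by simp [h0 j h], ?_⟩
    simp

theorem sum_indicator_mul_le (J : Finset ℕ) (X : ℕ → ℝ) (hX : ∀ j, X j = 0 ∨ X j = 1)
    (huniq : ∀ j j', X j = 1 → X j' = 1 → j = j') {t : ℝ} (ht : 0 ≤ t) :
    ∑ j ∈ J, X j * t ≤ t := by
  by_cases hj : ∃ j ∈ J, X j = 1
  · obtain ⟨j₀, hj₀, h1⟩ := hj
    rw [Finset.sum_eq_single_of_mem j₀ hj₀, h1, one_mul]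
    intro j _ hne
    rw [(hX j).resolve_right fun h => hne (huniq j j₀ h h1), zero_mul]
  · push Not at hj
    rw [Finset.sum_eq_zero]
    · exact ht
    · intro j h
      rw [(hX j).resolve_right (hj j h), zero_mul]

end HRASData

/-! ### Routes -/

section Route

variable {N : ℕ} {x : Fin N → Fin N → ℝ}

theorem IsRoute.ent_eq (hx : IsRoute x) (i : Fin N) (j : ℕ) : ent (x i) j = 0 ∨ ent (x i) j = 1 := by
  unfold ent
  split_ifs
  · exact hx.2.2 i _
  · exact Or.inl rfl

theorem IsRoute.ent_nonneg (hx : IsRoute x) (i : Fin N) (j : ℕ) : 0 ≤ ent (x i) j := by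
  rcases hx.ent_eq i j with h | h <;> simp [h]

theorem IsRoute.unique (hx : IsRoute x) (i : Fin N) (j j' : ℕ) (h : ent (x i) j = 1)
    (h' : ent (x i) j' = 1) : j = j' := by
  unfold ent at h h'
  split_ifs at h with hj
  · split_ifs at h' with hj'
    · by_contra hne
      have h1 := Finset.add_le_sum (f := x i) (s := Finset.univ)
        (fun j _ => by rcases hx.2.2 i j with h | h <;> simp [h])
        (Finset.mem_univ (⟨j - 1, by omega⟩ : Fin N))
        (Finset.mem_univ (⟨j' - 1, by omega⟩ : Fin N))
        (by rw [ne_eq, Fin.mk.injEq]; omega)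
      rw [hx.2.1 i, h, h'] at h1
      norm_num at h1
    · norm_num at h'
  · norm_num at h

theorem IsRoute.mul_eq (hx : IsRoute x) (i i' : Fin N) (j : ℕ) :
    ent (x i) (j - 1) * ent (x i') j = 0 ∨ ent (x i) (j - 1) * ent (x i') j = 1 := by
  rcases hx.ent_eq i (j - 1) with h | h <;> rcases hx.ent_eq i' j with h' | h' <;> simp [h, h']

theorem IsRoute.mul_nonneg (hx : IsRoute x) (i i' : Fin N) (j : ℕ) :
    0 ≤ ent (x i) (j - 1) * ent (x i') j := by
  rcases hx.mul_eq i i' j with h | h <;> simp [h]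

theorem IsRoute.mul_unique (hx : IsRoute x) (i i' : Fin N) (j j' : ℕ)
    (h : ent (x i) (j - 1) * ent (x i') j = 1) (h' : ent (x i) (j' - 1) * ent (x i') j' = 1) :
    j = j' :=
  hx.unique i' j j'
    ((hx.ent_eq i' j).resolve_left fun h0 => by simp [h0] at h)
    ((hx.ent_eq i' j').resolve_left fun h0 => by simp [h0] at h')

theorem IsRoute.pred_unique (hx : IsRoute x) (i : Fin N) (j j' : ℕ)
    (h : ent (x i) (j - 1) = 1) (h' : ent (x i) (j' - 1) = 1) : j = j' := by
  have h1 := hx.unique i _ _ h h'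
  -- Needed because of truncated subtraction: `0 - 1` and `1 - 1` agree, but the entry at `0` is
  -- zero.
  have h2 : 1 ≤ j - 1 := by
    by_contra h2
    rw [ent_eq_zero _ (by omega)] at h
    norm_num at h
  omega

end Route

theorem sum_Icc_one_eq_add (c : ℕ → ℝ) {k v : ℕ} (hk : 1 ≤ k) (hkv : k ≤ v) :
    ∑ j ∈ Finset.Icc 1 v, c j = ∑ j ∈ Finset.Icc 1 (k - 1), c j + ∑ j ∈ Finset.Icc k v, c j := by
  have h := sum_Icc_sub_pred (fun n => ∑ j ∈ Finset.Icc 1 n, c j) hkv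
  rw [← sub_eq_iff_eq_add', ← h]
  refine Finset.sum_congr rfl fun j hj => ?_
  obtain ⟨n, rfl⟩ : ∃ n, j = n + 1 := ⟨j - 1, by rw [Finset.mem_Icc] at hj; omega⟩
  simp only [Nat.add_sub_cancel]
  rw [Finset.sum_Icc_succ_top (by omega)]
  ring

theorem sum_Icc_ite_one (n : ℕ) (A : ℝ) (F : ℕ → ℝ) :
    ∑ j ∈ Finset.Icc 1 (n + 2), (if j = 1 then A else F j) = A + ∑ j ∈ Finset.Icc 2 (n + 2), F j := by
  rw [sum_Icc_eq_add_left (by omega), if_pos rfl]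
  congr 1
  refine Finset.sum_congr rfl fun j hj => ?_
  rw [Finset.mem_Icc] at hj
  rw [if_neg (by omega)]

theorem l1dist_eq {N : ℕ} (ξ m : Scenario N) :
    l1dist ξ m = ∑ i : Fin N, |ξ.travel 0 i.succ - m.travel 0 i.succ|
      + ∑ i : Fin N, |ξ.travel i.succ 0 - m.travel i.succ 0|
      + ∑ i : Fin N, ∑ i' ∈ Finset.univ.erase i,
          |ξ.travel i.succ i'.succ - m.travel i.succ i'.succ|
      + ∑ i, |ξ.service i - m.service i| := by
  have h0 : ∀ i, |ξ.travel i i - m.travel i i| = 0 := fun i => by simp [Scenario.travel]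
  have h1 : ∑ p, |ξ.1 p - m.1 p| =
      ∑ i, ∑ i', |ξ.travel i i' - m.travel i i'| := by
    rw [← Fintype.sum_prod_type' fun i i' => |ξ.travel i i' - m.travel i i'|,
      ← Finset.sum_filter_of_ne (p := fun p : Fin (N + 1) × Fin (N + 1) => p.1 ≠ p.2)]
    · rw [Finset.sum_subtype (p := fun p : Fin (N + 1) × Fin (N + 1) => p.1 ≠ p.2)
        (Finset.univ.filter _) (by simp)]
      refine Finset.sum_congr rfl fun p _ => ?_
      rw [Scenario.travel, Scenario.travel, dif_pos p.2, dif_pos p.2]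
    · intro p _ hp heq
      apply hp
      rw [heq, h0]
  have h2 : ∀ i : Fin N, ∑ i' ∈ Finset.univ.erase i,
      |ξ.travel i.succ i'.succ - m.travel i.succ i'.succ| =
      ∑ i' : Fin N, |ξ.travel i.succ i'.succ - m.travel i.succ i'.succ| := fun i =>
    Finset.sum_erase _ (h0 _)
  rw [l1dist, h1, Fin.sum_univ_succ, Fin.sum_univ_succ, h0]
  simp_rw [h2, Fin.sum_univ_succ (n := N) fun i' => |ξ.travel _ i' - m.travel _ i'|,
    Finset.sum_add_distrib]
  simp only [Scenario.service]
  ring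

/-! ### Worst-case arc lengths and corner realizations. -/

namespace HRASData

variable {N R : ℕ} {D : HRASData N}

/-- The return leg has the nonnegative coefficient `λ`, so moving down to the lower bound never pays
and that term can be dropped. -/
theorem uRetVal_eq_maxVal (hlam : 0 ≤ D.lam) {m : Scenario N} {i : Fin N} {ρ : ℝ} (hρ : 0 ≤ ρ)
    (h : D.lo.travel i.succ 0 ≤ m.travel i.succ 0) :
    D.uRetVal m i ρ = maxVal D.lam (D.lo.travel i.succ 0) (m.travel i.succ 0)
      (D.hi.travel i.succ 0) ρ := by
  rw [uRetVal, maxVal, max_eq_right (a := D.lam * D.lo.travel i.succ 0 - _)]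
  nlinarith

theorem lo_travel_le {ξ : Scenario N} (h : ξ ∈ D.support) (i i' : Fin (N + 1)) :
    D.lo.travel i i' ≤ ξ.travel i i' := by
  unfold Scenario.travel
  split_ifs
  · exact (h.1 _).2.1
  · exact le_rfl

theorem travel_le_hi {ξ : Scenario N} (h : ξ ∈ D.support) (i i' : Fin (N + 1)) :
    ξ.travel i i' ≤ D.hi.travel i i' := by
  unfold Scenario.travel
  split_ifs
  · exact (h.1 _).2.2
  · exact le_rfl

theorem lo_service_le {ξ : Scenario N} (h : ξ ∈ D.support) (i : Fin N) :
    D.lo.service i ≤ ξ.service i := (h.2 i).2.1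

theorem service_le_hi {ξ : Scenario N} (h : ξ ∈ D.support) (i : Fin N) :
    ξ.service i ≤ D.hi.service i := (h.2 i).2.2

/-- Contribution of position `j` to the length of an arc that ends in `v`. -/
noncomputable def arcTerm (D : HRASData N) (a : Fin N → ℝ) (σ : Fin N → ℕ → ℝ) (ζ : Fin N → ℕ → ℕ → ℝ)
    (φ : Fin N → Fin N → ℕ → ℕ → ℝ) (j v : ℕ) : ℝ :=
  if j = 1 then - D.apt a 1 * D.piC 1 v + ∑ i, σ i v
  else (D.apt a (j - 1) - D.apt a j) * D.piC j v + ∑ i, ζ i j v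
    + ∑ i, ∑ i' ∈ Finset.univ.erase i, φ i i' j v

/-- The arc lengths of the worst-case problem around the sample `m`, for the transport price `ρ`. -/
noncomputable def worstTerm (D : HRASData N) (m : Scenario N) (x : Fin N → Fin N → ℝ)
    (a : Fin N → ℝ) (ρ : ℝ) : ℕ → ℕ → ℝ :=
  D.arcTerm a (fun i v => D.uOutVal m i v ρ * ent (x i) 1)
    (fun i j v => D.νVal m i j v ρ * ent (x i) (j - 1))
    (fun i i' j v => D.uLinkVal m i i' j v ρ * (ent (x i) (j - 1) * ent (x i') j))

/-- Travel time to position `j`. -/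
noncomputable def legTime (x : Fin N → Fin N → ℝ) (ξ : Scenario N) (j : ℕ) : ℝ :=
  if j = 1 then ∑ i, ξ.travel 0 i.succ * ent (x i) 1
  else ∑ i, ∑ i' ∈ Finset.univ.erase i, ξ.travel i.succ i'.succ * ent (x i) (j - 1) * ent (x i') j

/-- Distance of two realizations in the coordinates that enter position `j`. -/
noncomputable def legDist (x : Fin N → Fin N → ℝ) (ξ m : Scenario N) (j : ℕ) : ℝ :=
  if j = 1 then ∑ i, ent (x i) 1 * |ξ.travel 0 i.succ - m.travel 0 i.succ|
  else ∑ i, ent (x i) (j - 1) * |ξ.service i - m.service i|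
    + ∑ i, ∑ i' ∈ Finset.univ.erase i, ent (x i) (j - 1) * ent (x i') j *
        |ξ.travel i.succ i'.succ - m.travel i.succ i'.succ|

theorem sum_legTime (x : Fin N → Fin N → ℝ) (ξ : Scenario N) :
    ∑ j ∈ Finset.Icc 1 (N + 2), legTime x ξ j + ∑ i, ξ.travel i.succ 0 * ent (x i) N =
      travelTotal x ξ := by
  have h0 : ∀ i, ∀ j, N < j → ent (x i) j = 0 := fun i j h => ent_eq_zero _ (by omega)
  have h1 : ∀ F : ℕ → ℝ, F (N + 1) = 0 → F (N + 2) = 0 →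
      ∑ j ∈ Finset.Icc 2 (N + 2), F j = ∑ j ∈ Finset.Icc 2 N, F j := by
    intro F h1 h2
    symm
    refine Finset.sum_subset (Finset.Icc_subset_Icc_right (by omega)) fun j hj hj' => ?_
    rw [Finset.mem_Icc] at hj hj'
    obtain rfl | rfl : j = N + 1 ∨ j = N + 2 := by omega
    · exact h1
    · exact h2
  unfold legTime travelTotal
  rw [sum_Icc_ite_one, h1, Finset.sum_add_distrib]
  · ring
  · simp [h0 _ (N + 1) (by omega)]
  · simp [h0 _ (N + 2) (by omega)]

theorem sum_legDist (x : Fin N → Fin N → ℝ) (ξ m : Scenario N) :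
    ∑ j ∈ Finset.Icc 1 (N + 2), legDist x ξ m j =
      ∑ i, ent (x i) 1 * |ξ.travel 0 i.succ - m.travel 0 i.succ|
      + ∑ i, ∑ i' ∈ Finset.univ.erase i, ∑ j ∈ Finset.Icc 2 (N + 2),
          ent (x i) (j - 1) * ent (x i') j * |ξ.travel i.succ i'.succ - m.travel i.succ i'.succ|
      + ∑ i, ∑ j ∈ Finset.Icc 2 (N + 2), ent (x i) (j - 1) * |ξ.service i - m.service i| := by
  unfold legDist
  rw [sum_Icc_ite_one, Finset.sum_add_distrib, Finset.sum_comm, Finset.sum_comm (t := Finset.univ)]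
  simp_rw [Finset.sum_comm (s := Finset.Icc 2 (N + 2)) (t := Finset.univ.erase _)]
  ring

/-- On a route no coordinate is counted at two positions. The inequality is strict when `ξ` differs
from `m` in a coordinate that the route does not use; worst corners are chosen without such
differences. -/
theorem sum_legDist_add_le {x : Fin N → Fin N → ℝ} (hx : IsRoute x) (ξ m : Scenario N) :
    ∑ j ∈ Finset.Icc 1 (N + 2), legDist x ξ m j
      + ∑ i, ent (x i) N * |ξ.travel i.succ 0 - m.travel i.succ 0| ≤ l1dist ξ m := by
  rw [sum_legDist, l1dist_eq]
  have h1 : ∀ (i : Fin N) (j : ℕ) (t : ℝ), 0 ≤ t → ent (x i) j * t ≤ t := fun i j t ht => by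
    rcases hx.ent_eq i j with h | h <;> simp [h, ht]
  have hout : ∑ i, ent (x i) 1 * |ξ.travel 0 i.succ - m.travel 0 i.succ| ≤
      ∑ i : Fin N, |ξ.travel 0 i.succ - m.travel 0 i.succ| :=
    Finset.sum_le_sum fun i _ => h1 _ _ _ (abs_nonneg _)
  have hret : ∑ i, ent (x i) N * |ξ.travel i.succ 0 - m.travel i.succ 0| ≤
      ∑ i : Fin N, |ξ.travel i.succ 0 - m.travel i.succ 0| :=
    Finset.sum_le_sum fun i _ => h1 _ _ _ (abs_nonneg _)
  have hlink : ∑ i, ∑ i' ∈ Finset.univ.erase i, ∑ j ∈ Finset.Icc 2 (N + 2),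
      ent (x i) (j - 1) * ent (x i') j * |ξ.travel i.succ i'.succ - m.travel i.succ i'.succ| ≤
      ∑ i : Fin N, ∑ i' ∈ Finset.univ.erase i,
        |ξ.travel i.succ i'.succ - m.travel i.succ i'.succ| :=
    Finset.sum_le_sum fun i _ => Finset.sum_le_sum fun i' _ =>
      sum_indicator_mul_le _ _ (hx.mul_eq i i') (hx.mul_unique i i') (abs_nonneg _)
  have hserv : ∑ i, ∑ j ∈ Finset.Icc 2 (N + 2), ent (x i) (j - 1) * |ξ.service i - m.service i| ≤
      ∑ i, |ξ.service i - m.service i| :=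
    Finset.sum_le_sum fun i _ =>
      sum_indicator_mul_le _ _ (fun j => hx.ent_eq i (j - 1)) (hx.pred_unique i) (abs_nonneg _)
  linarith

theorem sum_sub_mul {ι : Type*} (S : Finset ι) (p ρ : ℝ) (t c X : ι → ℝ) :
    ∑ i ∈ S, (p * t i - ρ * c i) * X i = p * ∑ i ∈ S, t i * X i - ρ * ∑ i ∈ S, X i * c i := by
  rw [Finset.mul_sum, Finset.mul_sum, ← Finset.sum_sub_distrib]
  exact Finset.sum_congr rfl fun i _ => by ring

/-- The contribution of position `j` splits over the coordinates that enter it. -/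
theorem rhs_mul_piC_eq (x : Fin N → Fin N → ℝ) (a : Fin N → ℝ) (ξ m : Scenario N) (ρ : ℝ)
    (j v : ℕ) :
    D.rhs x a ξ j * D.piC j v + D.lam * legTime x ξ j - ρ * legDist x ξ m j =
      D.arcTerm a
        (fun i v => ((D.piC 1 v + D.lam) * ξ.travel 0 i.succ
          - ρ * |ξ.travel 0 i.succ - m.travel 0 i.succ|) * ent (x i) 1)
        (fun i j v => (D.piC j v * ξ.service i - ρ * |ξ.service i - m.service i|)
          * ent (x i) (j - 1))
        (fun i i' j v => ((D.piC j v + D.lam) * ξ.travel i.succ i'.succ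
          - ρ * |ξ.travel i.succ i'.succ - m.travel i.succ i'.succ|)
          * (ent (x i) (j - 1) * ent (x i') j)) j v := by
  unfold arcTerm rhs legTime legDist
  split_ifs with hj
  · subst hj
    rw [sum_sub_mul]
    simp only [mul_comm (ent _ _) |_|]
    ring
  · rw [sum_sub_mul]
    simp_rw [sum_sub_mul]
    rw [Finset.sum_sub_distrib, ← Finset.mul_sum, ← Finset.mul_sum]
    simp only [mul_assoc, mul_comm (ent _ _) |_|, mul_comm (ent _ _ * ent _ _) |_|]
    ring

theorem arcTerm_mono {a : Fin N → ℝ} {σ σ' : Fin N → ℕ → ℝ} {ζ ζ' : Fin N → ℕ → ℕ → ℝ}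
    {φ φ' : Fin N → Fin N → ℕ → ℕ → ℝ} {j v : ℕ} (hσ : j = 1 → ∀ i, σ i v ≤ σ' i v)
    (hζ : j ≠ 1 → ∀ i, ζ i j v ≤ ζ' i j v)
    (hφ : j ≠ 1 → ∀ i, ∀ i' ∈ Finset.univ.erase i, φ i i' j v ≤ φ' i i' j v) :
    D.arcTerm a σ ζ φ j v ≤ D.arcTerm a σ' ζ' φ' j v := by
  unfold arcTerm
  split_ifs with hj
  · exact add_le_add le_rfl (Finset.sum_le_sum fun i _ => hσ hj i)
  · exact add_le_add (add_le_add le_rfl (Finset.sum_le_sum fun i _ => hζ hj i))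
      (Finset.sum_le_sum fun i _ => Finset.sum_le_sum fun i' hi' => hφ hj i i' hi')

/-- Every realization costs, up to its transport cost, at most any dominating potential. -/
theorem CostsOk.cost_le (hN : 0 < N) (hD : D.CostsOk) (hlam : 0 ≤ D.lam) {m ξ : Scenario N}
    (hm : m ∈ D.support) (hξ : ξ ∈ D.support) {x : Fin N → Fin N → ℝ} (hx : IsRoute x)
    {a : Fin N → ℝ} {ρ : ℝ} (hρ : 0 ≤ ρ) {B : ℕ → ℝ}
    (hB : Dominates B (D.worstTerm m x a ρ) (N + 2)) :
    D.cost x a ξ ≤ B (N + 2) - B 0 + ∑ i, D.uRetVal m i ρ * ent (x i) N + ρ * l1dist ξ m := by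
  have hterm : ∀ j v, D.rhs x a ξ j * D.piC j v + D.lam * legTime x ξ j - ρ * legDist x ξ m j ≤
      D.worstTerm m x a ρ j v := by
    intro j v
    rw [rhs_mul_piC_eq]
    refine arcTerm_mono (fun _ i => ?_) (fun _ i => ?_) (fun _ i i' _ => ?_)
    · exact mul_le_mul_of_nonneg_right
        (sub_mul_abs_le_maxVal (lo_travel_le hξ _ _) (travel_le_hi hξ _ _)) (hx.ent_nonneg _ _)
    · exact mul_le_mul_of_nonneg_right
        (sub_mul_abs_le_maxVal (lo_service_le hξ _) (service_le_hi hξ _)) (hx.ent_nonneg _ _)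
    · exact mul_le_mul_of_nonneg_right
        (sub_mul_abs_le_maxVal (lo_travel_le hξ _ _) (travel_le_hi hξ _ _))
        (hx.mul_nonneg _ _ _)
  -- Travel and transport costs depend on the position `j` but not on the arc covering it, so they
  -- can be moved from the arc lengths into the potential.
  have hdom : Dominates (fun v => B v + ∑ j ∈ Finset.Icc 1 v,
      (ρ * legDist x ξ m j - D.lam * legTime x ξ j))
      (fun j v => D.rhs x a ξ j * D.piC j v) (N + 2) := by
    intro k v hk hkv hv
    have h1 := hB k v hk hkv hv
    have h2 : ∑ j ∈ Finset.Icc k v, D.rhs x a ξ j * D.piC j v ≤ ∑ j ∈ Finset.Icc k v,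
        (D.worstTerm m x a ρ j v + (ρ * legDist x ξ m j - D.lam * legTime x ξ j)) :=
      Finset.sum_le_sum fun j _ => by linarith [hterm j v]
    rw [Finset.sum_add_distrib] at h2
    simp only [sum_Icc_one_eq_add _ hk hkv]
    linarith
  have h1 := greedyCost_le_of_dominates hdom
  rw [← hD.cost_eq hN] at h1
  simp only [Finset.Icc_eq_empty (by omega : ¬ 1 ≤ 0), Finset.sum_empty,
    Finset.sum_sub_distrib, ← Finset.mul_sum] at h1
  have h2 := sum_legTime x ξ
  have h3 := mul_le_mul_of_nonneg_left (sum_legDist_add_le hx ξ m) hρ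
  have h4 : ∑ i, (D.lam * ξ.travel i.succ 0 - ρ * |ξ.travel i.succ 0 - m.travel i.succ 0|)
      * ent (x i) N ≤ ∑ i, D.uRetVal m i ρ * ent (x i) N := by
    refine Finset.sum_le_sum fun i _ => mul_le_mul_of_nonneg_right ?_ (hx.ent_nonneg _ _)
    rw [uRetVal_eq_maxVal hlam hρ (lo_travel_le hm _ _)]
    exact sub_mul_abs_le_maxVal (lo_travel_le hξ _ _) (travel_le_hi hξ _ _)
  have h5 : ∑ i, (D.lam * ξ.travel i.succ 0 - ρ * |ξ.travel i.succ 0 - m.travel i.succ 0|)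
      * ent (x i) N = D.lam * ∑ i, ξ.travel i.succ 0 * ent (x i) N
      - ρ * ∑ i, ent (x i) N * |ξ.travel i.succ 0 - m.travel i.succ 0| :=
    sum_sub_mul _ _ _ _ _ _
  rw [← h2] at h1
  linarith

/-- The realizations whose coordinates are the bounds or those of the sample `m`. -/
def corners (D : HRASData N) (m : Scenario N) : Set (Scenario N) :=
  {ξ | (∀ p, ξ.1 p = D.lo.1 p ∨ ξ.1 p = m.1 p ∨ ξ.1 p = D.hi.1 p) ∧
       (∀ i, ξ.2 i = D.lo.2 i ∨ ξ.2 i = m.2 i ∨ ξ.2 i = D.hi.2 i)}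

theorem finite_corners (m : Scenario N) : (D.corners m).Finite := by
  refine ((Set.Finite.pi (t := fun p => {D.lo.1 p, m.1 p, D.hi.1 p}) fun p => Set.toFinite _).prod
    (Set.Finite.pi (t := fun i => {D.lo.2 i, m.2 i, D.hi.2 i}) fun i => Set.toFinite _)).subset ?_
  intro ξ hξ
  exact ⟨fun p _ => by simpa using hξ.1 p, fun i _ => by simpa using hξ.2 i⟩

theorem mem_corners_self (m : Scenario N) : m ∈ D.corners m :=
  ⟨fun _ => Or.inr (Or.inl rfl), fun _ => Or.inr (Or.inl rfl)⟩

theorem corners_subset_support (hlo_t : ∀ p, 0 ≤ D.lo.1 p) (hlo_d : ∀ i, 0 ≤ D.lo.2 i)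
    {m : Scenario N} (hm : m ∈ D.support) : D.corners m ⊆ D.support := by
  intro ξ hξ
  refine ⟨fun p => ?_, fun i => ?_⟩
  · have h1 := hm.1 p
    have h2 := hlo_t p
    rcases hξ.1 p with h | h | h <;> rw [h] <;> refine ⟨?_, ?_, ?_⟩ <;> linarith
  · have h1 := hm.2 i
    have h2 := hlo_d i
    rcases hξ.2 i with h | h | h <;> rw [h] <;> refine ⟨?_, ?_, ?_⟩ <;> linarith

/-- For a given path there is a corner that is the worst in all coordinates at once. -/
theorem exists_worst_corner (hlam : 0 ≤ D.lam) {m : Scenario N} (hm : m ∈ D.support)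
    {x : Fin N → Fin N → ℝ} (hx : IsRoute x) (a : Fin N → ℝ) {ρ : ℝ} (hρ : 0 ≤ ρ) (e : ℕ → ℕ) :
    ∃ ξ ∈ D.corners m,
      (∀ j ∈ Finset.Icc 1 (N + 2), D.worstTerm m x a ρ j (e j) ≤
        D.rhs x a ξ j * D.piC j (e j) + D.lam * legTime x ξ j - ρ * legDist x ξ m j) ∧
      (∑ i, D.uRetVal m i ρ * ent (x i) N ≤
        ∑ i, (D.lam * ξ.travel i.succ 0 - ρ * |ξ.travel i.succ 0 - m.travel i.succ 0|)
          * ent (x i) N) ∧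
      l1dist ξ m ≤ ∑ j ∈ Finset.Icc 1 (N + 2), legDist x ξ m j
        + ∑ i, ent (x i) N * |ξ.travel i.succ 0 - m.travel i.succ 0| := by
  -- The path `e` fixes the weight `π_{j, e j}` of every position. Each coordinate then meets at
  -- most one coefficient, and the choices are independent.
  choose tOut hOut hOut' hOut'' using fun i : Fin N => exists_worst_coordinate {1}
    (ent (x i)) (hx.ent_eq i) (hx.unique i)
    (fun j => D.piC 1 (e j) + D.lam) (lo_travel_le hm 0 i.succ) (travel_le_hi hm 0 i.succ) ρ
  choose tRet hRet hRet' hRet'' using fun i : Fin N => exists_worst_coordinate {N}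
    (ent (x i)) (hx.ent_eq i) (hx.unique i)
    (fun _ => D.lam) (lo_travel_le hm i.succ 0) (travel_le_hi hm i.succ 0) ρ
  choose tLink hLink hLink' hLink'' using fun i i' : Fin N =>
    exists_worst_coordinate (Finset.Icc 2 (N + 2)) (fun j => ent (x i) (j - 1) * ent (x i') j)
    (hx.mul_eq i i') (hx.mul_unique i i') (fun j => D.piC j (e j) + D.lam)
    (lo_travel_le hm i.succ i'.succ) (travel_le_hi hm i.succ i'.succ) ρ
  choose d hd hd' hd'' using fun i : Fin N =>
    exists_worst_coordinate (Finset.Icc 2 (N + 2)) (fun j => ent (x i) (j - 1))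
    (fun j => hx.ent_eq i (j - 1)) (hx.pred_unique i) (fun j => D.piC j (e j))
    (lo_service_le hm i) (service_le_hi hm i) ρ
  simp only [Finset.mem_singleton, forall_eq, Finset.sum_singleton] at hOut' hOut'' hRet' hRet''
  -- The diagonal entries of `T` are irrelevant, since arcs join distinct locations.
  let T : Fin (N + 1) → Fin (N + 1) → ℝ := fun k k' =>
    Fin.cases (Fin.cases 0 tOut k') (fun i => Fin.cases (tRet i) (tLink i) k') k
  let ξ : Scenario N := (fun p => T p.1.1 p.1.2, d)
  have e1 : ∀ i : Fin N, ξ.travel 0 i.succ = tOut i := fun i => by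
    rw [Scenario.travel, dif_pos (Fin.succ_ne_zero i).symm]; rfl
  have e2 : ∀ i : Fin N, ξ.travel i.succ 0 = tRet i := fun i => by
    rw [Scenario.travel, dif_pos (Fin.succ_ne_zero i)]; rfl
  have e3 : ∀ i, ∀ i' ∈ Finset.univ.erase i, ξ.travel i.succ i'.succ = tLink i i' := fun i i' h => by
    rw [Scenario.travel, dif_pos ((Fin.succ_injective N).ne (Finset.ne_of_mem_erase h).symm)]; rfl
  have e4 : ∀ i, ξ.service i = d i := fun i => rfl
  have key : ∀ (ξ' : Scenario N) (k k' : Fin (N + 1)) (h : k ≠ k'),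
      ξ'.1 ⟨(k, k'), h⟩ = ξ'.travel k k' := fun ξ' k k' h => by rw [Scenario.travel, dif_pos h]
  refine ⟨ξ, ⟨?_, hd⟩, ?_, ?_, ?_⟩
  · rintro ⟨⟨k, k'⟩, h⟩
    rw [key, key, key, key]
    induction k using Fin.cases with
    | zero =>
      induction k' using Fin.cases with
      | zero => exact absurd rfl h
      | succ i => rw [e1]; exact hOut i
    | succ i =>
      induction k' using Fin.cases with
      | zero => rw [e2]; exact hRet i
      | succ i' =>
        have h' : i' ∈ Finset.univ.erase i := by
          simp only [Finset.mem_erase, Finset.mem_univ, and_true]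
          rintro rfl
          exact h rfl
        rw [e3 i i' h']
        exact hLink i i'
  · intro j hj
    rw [rhs_mul_piC_eq]
    rw [Finset.mem_Icc] at hj
    refine arcTerm_mono (fun hj1 i => ?_) (fun hj1 i => ?_) (fun hj1 i i' hi' => ?_)
    · subst hj1
      simp only [e1]
      exact hOut' i
    · exact hd' i j (by simp; omega)
    · simp only [e3 i i' hi']
      exact hLink' i i' j (by simp; omega)
  · refine Finset.sum_le_sum fun i _ => ?_
    rw [uRetVal_eq_maxVal hlam hρ (lo_travel_le hm _ _), e2]
    exact hRet' i
  · rw [sum_legDist, l1dist_eq]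
    have g1 : ∑ i : Fin N, |ξ.travel 0 i.succ - m.travel 0 i.succ| ≤
        ∑ i, ent (x i) 1 * |ξ.travel 0 i.succ - m.travel 0 i.succ| :=
      Finset.sum_le_sum fun i _ => by rw [e1]; exact hOut'' i
    have g2 : ∑ i : Fin N, |ξ.travel i.succ 0 - m.travel i.succ 0| ≤
        ∑ i, ent (x i) N * |ξ.travel i.succ 0 - m.travel i.succ 0| :=
      Finset.sum_le_sum fun i _ => by rw [e2]; exact hRet'' i
    have g3 : ∑ i : Fin N, ∑ i' ∈ Finset.univ.erase i,
        |ξ.travel i.succ i'.succ - m.travel i.succ i'.succ| ≤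
        ∑ i, ∑ i' ∈ Finset.univ.erase i, ∑ j ∈ Finset.Icc 2 (N + 2),
          ent (x i) (j - 1) * ent (x i') j * |ξ.travel i.succ i'.succ - m.travel i.succ i'.succ| :=
      Finset.sum_le_sum fun i _ => Finset.sum_le_sum fun i' hi' => by
        rw [e3 i i' hi']; exact hLink'' i i'
    have g4 : ∑ i, |ξ.service i - m.service i| ≤
        ∑ i, ∑ j ∈ Finset.Icc 2 (N + 2), ent (x i) (j - 1) * |ξ.service i - m.service i| :=
      Finset.sum_le_sum fun i _ => hd'' i
    linarith

/-- Some dominating potential is attained by the cost of a corner. -/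
theorem CostsOk.exists_dominates_corner (hN : 0 < N) (hD : D.CostsOk) (hlam : 0 ≤ D.lam)
    {m : Scenario N} (hm : m ∈ D.support) {x : Fin N → Fin N → ℝ} (hx : IsRoute x)
    (a : Fin N → ℝ) {ρ : ℝ} (hρ : 0 ≤ ρ) :
    ∃ B : ℕ → ℝ, Dominates B (D.worstTerm m x a ρ) (N + 2) ∧ ∃ ξ ∈ D.corners m,
      B (N + 2) - B 0 + ∑ i, D.uRetVal m i ρ * ent (x i) N ≤ D.cost x a ξ - ρ * l1dist ξ m := by
  obtain ⟨B, hB0, hBd, hB⟩ := exists_longest_path (D.worstTerm m x a ρ) (N + 2)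
  obtain ⟨e, -, hBe, hopt⟩ := hB (N + 2) le_rfl
  obtain ⟨ξ, hξ, h1, h2, h3⟩ := exists_worst_corner hlam hm hx a hρ e
  refine ⟨B, hBd, ξ, hξ, ?_⟩
  have hmem := greedyCost_mem (D := D) hN x a ξ
  rw [← hD.cost_eq hN] at hmem
  obtain ⟨B', hB', hcost⟩ := hD.exists_dominates hN hmem
  -- `B'` dominates the true arc lengths at the corner, so the cost there is at least the length of
  -- the path `e`, although `e` was chosen for the worst-case lengths.
  have h4 := hopt _ B' hB'
  have h5 := Finset.sum_le_sum h1
  rw [← hBe, Finset.sum_sub_distrib, Finset.sum_add_distrib, ← Finset.mul_sum,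
    ← Finset.mul_sum] at h5
  have h6 := sum_legTime x ξ
  have h7 := mul_le_mul_of_nonneg_left h3 hρ
  have h8 : ∑ i, (D.lam * ξ.travel i.succ 0 - ρ * |ξ.travel i.succ 0 - m.travel i.succ 0|)
      * ent (x i) N = D.lam * ∑ i, ξ.travel i.succ 0 * ent (x i) N
      - ρ * ∑ i, ent (x i) N * |ξ.travel i.succ 0 - m.travel i.succ 0| :=
    sum_sub_mul _ _ _ _ _ _
  rw [← h6] at hcost
  rw [hcost, hB0]
  linarith

end HRASData

/-! ### The MILP -/

namespace HRASData

variable {N R : ℕ} {D : HRASData N}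

/-- The truncation at `min v (N + 1)` loses nothing: at position `N + 2` the weight `π_{N+2,N+2}`
and the products vanish. -/
theorem sum_arcTerm_of_two_le {a : Fin N → ℝ} {σ : Fin N → ℕ → ℝ} {ζ : Fin N → ℕ → ℕ → ℝ}
    {φ : Fin N → Fin N → ℕ → ℕ → ℝ} (hζ : ∀ i v, ζ i (N + 2) v = 0)
    (hφ : ∀ i i' v, φ i i' (N + 2) v = 0) {k v : ℕ} (hk : 2 ≤ k) (hv : v ≤ N + 2) :
    ∑ j ∈ Finset.Icc k v, D.arcTerm a σ ζ φ j v =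
      ∑ j ∈ Finset.Icc k (min v (N + 1)), (D.apt a (j - 1) - D.apt a j) * D.piC j v
      + ∑ j ∈ Finset.Icc k (min v (N + 1)), ∑ i, ζ i j v
      + ∑ j ∈ Finset.Icc k (min v (N + 1)), ∑ i, ∑ i' ∈ Finset.univ.erase i, φ i i' j v := by
  rw [← Finset.sum_add_distrib, ← Finset.sum_add_distrib]
  have h : ∑ j ∈ Finset.Icc k v, D.arcTerm a σ ζ φ j v =
      ∑ j ∈ Finset.Icc k (min v (N + 1)), D.arcTerm a σ ζ φ j v := by
    symm
    refine Finset.sum_subset (Finset.Icc_subset_Icc_right (min_le_left _ _)) fun j hj hj' => ?_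
    rw [Finset.mem_Icc] at hj hj'
    obtain rfl : j = N + 2 := by omega
    obtain rfl : v = N + 2 := by omega
    rw [arcTerm, if_neg (by omega), piC_last]
    simp [hζ, hφ]
  rw [h]
  refine Finset.sum_congr rfl fun j hj => ?_
  rw [Finset.mem_Icc] at hj
  rw [arcTerm, if_neg (by omega)]

/-- The constraints on `β` say that its partial sums dominate the arc lengths. -/
theorem dominates_arcTerm_iff {a : Fin N → ℝ} {σ : Fin N → ℕ → ℝ} {ζ : Fin N → ℕ → ℕ → ℝ}
    {φ : Fin N → Fin N → ℕ → ℕ → ℝ} (hζ : ∀ i v, ζ i (N + 2) v = 0)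
    (hφ : ∀ i i' v, φ i i' (N + 2) v = 0) {β : ℕ → ℝ} :
    Dominates (fun v => ∑ j ∈ Finset.Icc 1 v, β j) (D.arcTerm a σ ζ φ) (N + 2) ↔
      β 1 ≥ - D.apt a 1 * D.piC 1 1 + ∑ i, σ i 1 ∧
      (∀ v ∈ Finset.Icc 2 (N + 2), ∑ j ∈ Finset.Icc 1 v, β j ≥ - D.apt a 1 * D.piC 1 v
        + ∑ j ∈ Finset.Icc 2 (min v (N + 1)), (D.apt a (j - 1) - D.apt a j) * D.piC j v
        + ∑ i, σ i v
        + ∑ j ∈ Finset.Icc 2 (min v (N + 1)), ∑ i, ∑ i' ∈ Finset.univ.erase i, φ i i' j v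
        + ∑ j ∈ Finset.Icc 2 (min v (N + 1)), ∑ i, ζ i j v) ∧
      (∀ k ∈ Finset.Icc 2 (N + 1), ∀ v ∈ Finset.Icc k (N + 2), ∑ j ∈ Finset.Icc k v, β j ≥
        ∑ j ∈ Finset.Icc k (min v (N + 1)), (D.apt a (j - 1) - D.apt a j) * D.piC j v
        + ∑ j ∈ Finset.Icc k (min v (N + 1)), ∑ i, ζ i j v
        + ∑ j ∈ Finset.Icc k (min v (N + 1)), ∑ i, ∑ i' ∈ Finset.univ.erase i, φ i i' j v) ∧
      β (N + 2) ≥ 0 := by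
  have hβ : ∀ k v, 1 ≤ k → k ≤ v → ∑ j ∈ Finset.Icc 1 v, β j - ∑ j ∈ Finset.Icc 1 (k - 1), β j =
      ∑ j ∈ Finset.Icc k v, β j := fun k v hk hkv => by
    rw [sum_Icc_one_eq_add β hk hkv]
    ring
  have hone : ∀ v, D.arcTerm a σ ζ φ 1 v = - D.apt a 1 * D.piC 1 v + ∑ i, σ i v :=
    fun v => if_pos rfl
  constructor
  · intro h
    refine ⟨?_, fun v hv => ?_, fun k hk v hv => ?_, ?_⟩
    · have h1 := h 1 1 le_rfl le_rfl (by omega)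
      simpa [hone] using h1
    · rw [Finset.mem_Icc] at hv
      have h1 := h 1 v le_rfl (by omega) hv.2
      simp only [hβ 1 v le_rfl (by omega)] at h1
      rw [sum_Icc_eq_add_left (by omega), hone, sum_arcTerm_of_two_le hζ hφ (by omega) hv.2] at h1
      linarith
    · rw [Finset.mem_Icc] at hk hv
      have h1 := h k v (by omega) hv.1 hv.2
      simp only [hβ k v (by omega) hv.1] at h1
      rw [sum_arcTerm_of_two_le hζ hφ (by omega) hv.2] at h1
      exact h1
    · have h1 := h (N + 2) (N + 2) (by omega) le_rfl le_rfl
      simp only [hβ (N + 2) (N + 2) (by omega) le_rfl] at h1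
      rw [sum_arcTerm_of_two_le hζ hφ (by omega) le_rfl] at h1
      simpa using h1
  · rintro ⟨h1, h2, h3, h4⟩ k v hk hkv hv
    simp only [hβ k v hk hkv]
    rcases Nat.lt_or_ge 1 k with hk1 | hk1
    · rw [sum_arcTerm_of_two_le hζ hφ hk1 hv]
      rcases Nat.lt_or_ge (N + 1) k with hk2 | hk2
      · obtain rfl : k = N + 2 := by omega
        obtain rfl : v = N + 2 := by omega
        simpa using h4
      · exact h3 k (by simp; omega) v (by simp; omega)
    · obtain rfl : k = 1 := by omega
      rw [sum_Icc_eq_add_left hkv, hone]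
      rcases Nat.lt_or_ge 1 v with hv1 | hv1
      · rw [sum_arcTerm_of_two_le hζ hφ le_rfl hv]
        have := h2 v (by simp; omega)
        linarith
      · obtain rfl : v = 1 := by omega
        simpa using h1

theorem MILPFeasible.τ_eq {s : Fin R → Scenario N} {y : MILPVars N R} (hy : D.MILPFeasible s y)
    (i : Fin N) (i' : Fin N) (hi : i' ∈ Finset.univ.erase i) (j : ℕ)
    (hj : j ∈ Finset.Icc 2 (N + 1)) :
    ent (y.τ i i') j = ent (y.x i) (j - 1) * ent (y.x i') j := by
  obtain ⟨h1, h2, h3, h4⟩ := hy.mc_τ i i' hi j hj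
  rcases hy.route.ent_eq i (j - 1) with h | h <;> rcases hy.route.ent_eq i' j with h' | h' <;>
    simp only [h, h'] at h1 h3 h4 ⊢ <;> linarith

theorem MILPFeasible.productsExact {s : Fin R → Scenario N} {y : MILPVars N R}
    (hy : D.MILPFeasible s y) : D.ProductsExact y := by
  refine ⟨hy.τ_eq, fun r i => ?_, fun r i v hv => ?_, fun r i i' hi j hj v hv => ?_,
    fun r i j hj v hv => ?_⟩
  · exact ((mcCormick_iff (hy.route.ent_eq i N)).1 (hy.mc_ψ r i)).1
  · exact ((mcCormick_iff (hy.route.ent_eq i 1)).1 (hy.mc_σ r i v hv)).1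
  · have h := hy.mc_φ r i i' hi j hj v hv
    rw [hy.τ_eq i i' hi j hj, mcCormick_iff (hy.route.mul_eq i i' j)] at h
    exact h.1
  · exact ((mcCormick_iff (hy.route.ent_eq i (j - 1))).1 (hy.mc_ζ r i j hj v hv)).1

theorem ent₂_eq_zero_left {m n : ℕ} (f : Fin m → Fin n → ℝ) {j : ℕ} (h : m < j) (v : ℕ) :
    ent₂ f j v = 0 := ent_eq_zero _ (by omega)

/-- With exact products, the arc lengths in the MILP only increase when the `u` and `ν` variables
exceed their explicit values, because they are multiplied by nonnegative indicators. -/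
theorem MILPFeasible.dominates {s : Fin R → Scenario N} {y : MILPVars N R}
    (hy : D.MILPFeasible s y) (r : Fin R) :
    Dominates (fun v => ∑ j ∈ Finset.Icc 1 v, ent (y.β r) j)
      (D.worstTerm (s r) y.x y.a y.rho) (N + 2) := by
  obtain ⟨-, -, hσ, hφ, hζ⟩ := hy.productsExact
  have h := (dominates_arcTerm_iff (D := D) (a := y.a) (σ := fun i => ent (y.σ r i))
    (ζ := fun i => ent₂ (y.ζ r i)) (φ := fun i i' => ent₂ (y.φ r i i'))
    (fun i v => ent₂_eq_zero_left _ (by omega) v)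
    (fun i i' v => ent₂_eq_zero_left _ (by omega) v)).2
    ⟨hy.β_first r, hy.β_from_one r, hy.β_from_k r, hy.β_last r⟩
  refine h.mono fun j v hj hjv hv => arcTerm_mono (fun hj1 i => ?_) (fun hj1 i => ?_)
    (fun hj1 i i' hi' => ?_)
  · have hv' : v ∈ Finset.Icc 1 (N + 2) := by simp; omega
    rw [hσ r i v hv']
    have h' := hy.uOut_ge r i v hv'
    exact mul_le_mul_of_nonneg_right (max_le (max_le h'.1 h'.2.1) h'.2.2) (hy.route.ent_nonneg _ _)
  · rcases Nat.lt_or_ge (N + 1) j with hjN | hjN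
    · rw [ent₂_eq_zero_left _ hjN, ent_eq_zero (y.x i) (by omega), mul_zero]
    · have hj' : j ∈ Finset.Icc 2 (N + 1) := by simp; omega
      have hv' : v ∈ Finset.Icc j (N + 2) := by simp; omega
      rw [hζ r i j hj' v hv']
      have h' := hy.ν_ge r i j hj' v hv'
      exact mul_le_mul_of_nonneg_right (max_le (max_le h'.1 h'.2.2) h'.2.1)
        (hy.route.ent_nonneg _ _)
  · rcases Nat.lt_or_ge (N + 1) j with hjN | hjN
    · rw [ent₂_eq_zero_left _ hjN, ent_eq_zero (y.x i) (by omega), zero_mul, mul_zero]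
    · have hj' : j ∈ Finset.Icc 2 (N + 1) := by simp; omega
      have hv' : v ∈ Finset.Icc j (N + 2) := by simp; omega
      rw [hφ r i i' hi' j hj' v hv']
      have h' := hy.uLink_ge r i i' hi' j hj' v hv'
      exact mul_le_mul_of_nonneg_right (max_le (max_le h'.1 h'.2.2) h'.2.1)
        (hy.route.mul_nonneg _ _ _)

theorem MILPFeasible.sum_uRetVal_le {s : Fin R → Scenario N} {y : MILPVars N R}
    (hy : D.MILPFeasible s y) (r : Fin R) :
    ∑ i, D.uRetVal (s r) i y.rho * ent (y.x i) N ≤ ∑ i, y.ψ r i := by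
  obtain ⟨-, hψ, -⟩ := hy.productsExact
  refine Finset.sum_le_sum fun i _ => ?_
  rw [hψ r i]
  have h' := hy.uRet_ge r i
  exact mul_le_mul_of_nonneg_right (max_le h'.1 h'.2) (hy.route.ent_nonneg _ _)

theorem tightBounds_uRetVal (hlam : 0 ≤ D.lam) {m : Scenario N} (hm : m ∈ D.support) (i : Fin N) :
    TightBounds (D.uRetVal m i) (D.uRetLo m i) (D.uRetHi i) := by
  have hlm := lo_travel_le hm i.succ 0
  have hmh := travel_le_hi hm i.succ 0
  have himg : D.uRetVal m i '' Set.Ici 0 = maxVal D.lam (D.lo.travel i.succ 0)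
      (m.travel i.succ 0) (D.hi.travel i.succ 0) '' Set.Ici 0 :=
    Set.image_congr fun ρ hρ => uRetVal_eq_maxVal hlam hρ hlm
  have h := tightBounds_maxVal (c := D.lam) hlm hmh
  rw [max_eq_right (mul_le_mul_of_nonneg_left (hlm.trans hmh) hlam)] at h
  unfold TightBounds at h ⊢
  rwa [himg]

theorem boundsTight (hlam : 0 ≤ D.lam) {s : Fin R → Scenario N} (hs : ∀ r, s r ∈ D.support) :
    D.BoundsTight s :=
  ⟨fun r i => tightBounds_uRetVal hlam (hs r) i,
    fun r _ _ _ => tightBounds_maxVal (lo_travel_le (hs r) _ _) (travel_le_hi (hs r) _ _),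
    fun r _ _ _ _ _ _ _ => tightBounds_maxVal (lo_travel_le (hs r) _ _) (travel_le_hi (hs r) _ _),
    fun r _ _ _ _ _ => tightBounds_maxVal (lo_service_le (hs r) _) (service_le_hi (hs r) _)⟩

/-- The point of the MILP with explicit `u` and `ν` values and exact products. -/
noncomputable def explicitPoint (D : HRASData N) (s : Fin R → Scenario N) (x : Fin N → Fin N → ℝ)
    (a : Fin N → ℝ) (ρ : ℝ) (B : Fin R → ℕ → ℝ) : MILPVars N R where
  x := x
  a := a
  rho := ρ
  β r j := B r (j + 1) - B r (j + 1 - 1)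
  uRet r i := D.uRetVal (s r) i ρ
  uOut r i v := D.uOutVal (s r) i (v + 1) ρ
  uLink r i i' j v := D.uLinkVal (s r) i i' (j + 1) (v + 1) ρ
  ν r i j v := D.νVal (s r) i (j + 1) (v + 1) ρ
  τ i i' j := ent (x i) (j + 1 - 1) * ent (x i') (j + 1)
  ψ r i := D.uRetVal (s r) i ρ * ent (x i) N
  σ r i v := D.uOutVal (s r) i (v + 1) ρ * ent (x i) 1
  φ r i i' j v := D.uLinkVal (s r) i i' (j + 1) (v + 1) ρ *
    (ent (x i) (j + 1 - 1) * ent (x i') (j + 1))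
  ζ r i j v := D.νVal (s r) i (j + 1) (v + 1) ρ * ent (x i) (j + 1 - 1)

theorem sum_β_explicitPoint {s : Fin R → Scenario N} {x : Fin N → Fin N → ℝ} {a : Fin N → ℝ}
    {ρ : ℝ} {B : Fin R → ℕ → ℝ} (r : Fin R) {v : ℕ} (hv : v ≤ N + 2) :
    ∑ j ∈ Finset.Icc 1 v, ent ((D.explicitPoint s x a ρ B).β r) j = B r v - B r 0 := by
  have h : ∑ j ∈ Finset.Icc 1 v, ent ((D.explicitPoint s x a ρ B).β r) j =
      ∑ j ∈ Finset.Icc 1 v, (B r j - B r (j - 1)) := by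
    refine Finset.sum_congr rfl fun j hj => ?_
    rw [Finset.mem_Icc] at hj
    exact ent_of_mem (fun j => B r j - B r (j - 1)) hj.1 (by omega)
  rw [h]
  rcases Nat.eq_zero_or_pos v with rfl | hv0
  · simp
  · exact sum_Icc_sub_pred _ hv0

theorem milpObj_explicitPoint (ε : ℝ) {s : Fin R → Scenario N} {x : Fin N → Fin N → ℝ}
    {a : Fin N → ℝ} {ρ : ℝ} {B : Fin R → ℕ → ℝ} :
    D.milpObj ε (D.explicitPoint s x a ρ B) = ε * ρ + (R : ℝ)⁻¹ * ∑ r,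
      (B r (N + 2) - B r 0 + ∑ i, D.uRetVal (s r) i ρ * ent (x i) N) := by
  unfold milpObj
  simp only [sum_β_explicitPoint _ le_rfl]
  simp only [explicitPoint, add_comm]

/-- The upper McCormick bounds cut off nothing needed: for every `ρ ≥ 0` the explicit values lie
between the prescribed bounds. -/
theorem milpFeasible_explicitPoint (hlam : 0 ≤ D.lam) {s : Fin R → Scenario N}
    (hs : ∀ r, s r ∈ D.support) {x : Fin N → Fin N → ℝ} (hx : IsRoute x) {a : Fin N → ℝ}
    (ha : D.IsSchedule a) {ρ : ℝ} (hρ : 0 ≤ ρ) {B : Fin R → ℕ → ℝ}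
    (hB : ∀ r, Dominates (B r) (D.worstTerm (s r) x a ρ) (N + 2)) :
    D.MILPFeasible s (D.explicitPoint s x a ρ B) := by
  set y := D.explicitPoint s x a ρ B with hy
  have eτ : ∀ i i' j, 1 ≤ j → j ≤ N + 1 →
      ent (y.τ i i') j = ent (x i) (j - 1) * ent (x i') j := fun i i' j h1 h2 =>
    ent_of_mem (fun j => ent (x i) (j - 1) * ent (x i') j) h1 h2
  have eOut : ∀ r i v, 1 ≤ v → v ≤ N + 2 → ent (y.uOut r i) v = D.uOutVal (s r) i v ρ :=
    fun r i v h1 h2 => ent_of_mem (fun v => D.uOutVal (s r) i v ρ) h1 h2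
  have eσ : ∀ r i v, 1 ≤ v → v ≤ N + 2 →
      ent (y.σ r i) v = D.uOutVal (s r) i v ρ * ent (x i) 1 :=
    fun r i v h1 h2 => ent_of_mem (fun v => D.uOutVal (s r) i v ρ * ent (x i) 1) h1 h2
  have eLink : ∀ r i i' j v, 1 ≤ j → j ≤ N + 1 → 1 ≤ v → v ≤ N + 2 →
      ent₂ (y.uLink r i i') j v = D.uLinkVal (s r) i i' j v ρ := fun r i i' j v h1 h2 h3 h4 =>
    ent₂_of_mem (fun j v => D.uLinkVal (s r) i i' j v ρ) h1 h2 h3 h4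
  have eφ : ∀ r i i' j v, 1 ≤ j → j ≤ N + 1 → 1 ≤ v → v ≤ N + 2 → ent₂ (y.φ r i i') j v =
      D.uLinkVal (s r) i i' j v ρ * (ent (x i) (j - 1) * ent (x i') j) :=
    fun r i i' j v h1 h2 h3 h4 => ent₂_of_mem
      (fun j v => D.uLinkVal (s r) i i' j v ρ * (ent (x i) (j - 1) * ent (x i') j)) h1 h2 h3 h4
  have eν : ∀ r i j v, 1 ≤ j → j ≤ N + 1 → 1 ≤ v → v ≤ N + 2 →
      ent₂ (y.ν r i) j v = D.νVal (s r) i j v ρ := fun r i j v h1 h2 h3 h4 =>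
    ent₂_of_mem (fun j v => D.νVal (s r) i j v ρ) h1 h2 h3 h4
  have eζ : ∀ r i j v, 1 ≤ j → j ≤ N + 1 → 1 ≤ v → v ≤ N + 2 → ent₂ (y.ζ r i) j v =
      D.νVal (s r) i j v ρ * ent (x i) (j - 1) := fun r i j v h1 h2 h3 h4 =>
    ent₂_of_mem (fun j v => D.νVal (s r) i j v ρ * ent (x i) (j - 1)) h1 h2 h3 h4
  have hdom : ∀ r, Dominates (fun v => ∑ j ∈ Finset.Icc 1 v, ent (y.β r) j)
      (D.arcTerm a (fun i => ent (y.σ r i)) (fun i => ent₂ (y.ζ r i))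
        (fun i i' => ent₂ (y.φ r i i'))) (N + 2) := by
    intro r k v hk hkv hv
    have h1 := ((hB r).mono (g' := D.arcTerm a (fun i => ent (y.σ r i))
      (fun i => ent₂ (y.ζ r i)) (fun i i' => ent₂ (y.φ r i i'))) ?_) k v hk hkv hv
    · simp only [hy, sum_β_explicitPoint r hv, sum_β_explicitPoint r (by omega : k - 1 ≤ N + 2)]
      linarith
    · intro j v hj hjv hv
      refine arcTerm_mono (fun hj1 i => ?_) (fun hj1 i => ?_) (fun hj1 i i' hi' => ?_)
      · rw [eσ r i v (by omega) hv]
      · rcases Nat.lt_or_ge (N + 1) j with hjN | hjN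
        · rw [ent₂_eq_zero_left _ hjN, ent_eq_zero (x i) (by omega), mul_zero]
        · rw [eζ r i j v hj hjN (by omega) hv]
      · rcases Nat.lt_or_ge (N + 1) j with hjN | hjN
        · rw [ent₂_eq_zero_left _ hjN, ent_eq_zero (x i) (by omega), zero_mul, mul_zero]
        · rw [eφ r i i' j v hj hjN (by omega) hv]
  have hcon := fun r => (dominates_arcTerm_iff
    (fun i v => ent₂_eq_zero_left _ (by omega) v)
    (fun i i' v => ent₂_eq_zero_left _ (by omega) v)).1 (hdom r)
  have hT := fun r i => tightBounds_uRetVal hlam (hs r) i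
  refine
    { route := hx
      schedule := ha
      rho_nonneg := hρ
      mc_τ := fun i i' hi j hj => ?_
      mc_ψ := fun r i => ?_
      mc_φ := fun r i i' hi j hj v hv => ?_
      mc_σ := fun r i v hv => ?_
      mc_ζ := fun r i j hj v hv => ?_
      β_first := fun r => (hcon r).1
      β_from_one := fun r => (hcon r).2.1
      β_from_k := fun r => (hcon r).2.2.1
      β_last := fun r => (hcon r).2.2.2
      uRet_ge := fun r i => ⟨le_max_left _ _, le_max_right _ _⟩
      uOut_ge := fun r i v hv => ?_
      uLink_ge := fun r i i' hi j hj v hv => ?_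
      ν_ge := fun r i j hj v hv => ?_ }
  · rw [Finset.mem_Icc] at hj
    rw [eτ i i' j (by omega) hj.2]
    change ent (x i) (j - 1) + ent (x i') j - 1 ≤ _ ∧ _ ∧ _ ≤ ent (x i) (j - 1) ∧
      _ ≤ ent (x i') j
    rcases hx.ent_eq i (j - 1) with h | h <;> rcases hx.ent_eq i' j with h' | h' <;>
      rw [h, h'] <;> norm_num
  · exact (mcCormick_iff (hx.ent_eq i N)).2 ⟨rfl, (hT r i).1.2 ⟨ρ, hρ, rfl⟩,
      (hT r i).2.2 ⟨ρ, hρ, rfl⟩⟩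
  · rw [Finset.mem_Icc] at hj hv
    rw [eτ i i' j (by omega) hj.2, eφ r i i' j v (by omega) hj.2 (by omega) hv.2,
      eLink r i i' j v (by omega) hj.2 (by omega) hv.2]
    exact (mcCormick_iff (hx.mul_eq i i' j)).2 ⟨rfl, mul_le_maxVal _ _ _ _ _,
      maxVal_le hρ (lo_travel_le (hs r) _ _) (travel_le_hi (hs r) _ _)⟩
  · rw [Finset.mem_Icc] at hv
    rw [eσ r i v hv.1 hv.2, eOut r i v hv.1 hv.2]
    exact (mcCormick_iff (hx.ent_eq i 1)).2 ⟨rfl, mul_le_maxVal _ _ _ _ _,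
      maxVal_le hρ (lo_travel_le (hs r) _ _) (travel_le_hi (hs r) _ _)⟩
  · rw [Finset.mem_Icc] at hj hv
    rw [eζ r i j v (by omega) hj.2 (by omega) hv.2, eν r i j v (by omega) hj.2 (by omega) hv.2]
    exact (mcCormick_iff (hx.ent_eq i (j - 1))).2 ⟨rfl, mul_le_maxVal _ _ _ _ _,
      maxVal_le hρ (lo_service_le (hs r) _) (service_le_hi (hs r) _)⟩
  · rw [Finset.mem_Icc] at hv
    rw [eOut r i v hv.1 hv.2]
    exact ⟨(le_max_left _ _).trans (le_max_left _ _), mul_le_maxVal _ _ _ _ _, le_max_right _ _⟩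
  · rw [Finset.mem_Icc] at hj hv
    rw [eLink r i i' j v (by omega) hj.2 (by omega) hv.2]
    exact ⟨(le_max_left _ _).trans (le_max_left _ _), le_max_right _ _, mul_le_maxVal _ _ _ _ _⟩
  · rw [Finset.mem_Icc] at hj hv
    rw [eν r i j v (by omega) hj.2 (by omega) hv.2]
    exact ⟨(le_max_left _ _).trans (le_max_left _ _), le_max_right _ _, mul_le_maxVal _ _ _ _ _⟩

end HRASData

/-! ### A saddle point of finitely many affine functions -/

open Filter Topology in
-- Minimise the upper envelope of the lines `A k + ρ * B k` over `ρ ≥ 0`. At a minimiser some active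
-- line has slope at least `0`, and if `ρ > 0` another has slope at most `0`; a convex combination
-- of the two has slope `0`, so its intercept equals the minimum. In the application `A` is a mean
-- cost and `B` is the unused transport budget.
theorem exists_saddle {K : Type*} [Finite K] (A B : K → ℝ) {k₀ : K} (hk₀ : 0 < B k₀) :
    ∃ ρ, 0 ≤ ρ ∧ ∃ k₁ k₂ θ, 0 ≤ θ ∧ θ ≤ 1 ∧
      (∀ k, A k + ρ * B k ≤ θ * A k₁ + (1 - θ) * A k₂) ∧
      0 ≤ θ * B k₁ + (1 - θ) * B k₂ := by
  have := Fintype.ofFinite K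
  have hne : (Finset.univ : Finset K).Nonempty := ⟨k₀, Finset.mem_univ _⟩
  let G : ℝ → ℝ := fun ρ => Finset.univ.sup' hne fun k => A k + ρ * B k
  have hle : ∀ ρ k, A k + ρ * B k ≤ G ρ := fun ρ k =>
    Finset.le_sup' (fun k => A k + ρ * B k) (Finset.mem_univ k)
  have hcont : Continuous G :=
    Continuous.finset_sup'_apply hne fun k _ => by fun_prop
  -- Beyond `M` the increasing line `k₀` already lies above `G 0`, so minimising over `[0, M]`
  -- suffices.
  set M := max 0 ((G 0 - A k₀) / B k₀) with hM
  obtain ⟨ρ, hρ, hmin⟩ := isCompact_Icc.exists_isMinOn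
    ⟨0, Set.left_mem_Icc.2 (le_max_left 0 _ : 0 ≤ M)⟩ hcont.continuousOn
  have hmin' : ∀ ρ', 0 ≤ ρ' → G ρ ≤ G ρ' := by
    intro ρ' h0
    rcases le_total ρ' M with h | h
    · exact hmin ⟨h0, h⟩
    · refine (hmin ⟨le_rfl, le_max_left _ _⟩).trans (le_trans ?_ (hle ρ' k₀))
      have h1 : (G 0 - A k₀) / B k₀ ≤ ρ' := (le_max_right _ _).trans h
      rw [div_le_iff₀ hk₀] at h1
      linarith
  -- If every active line dropped along `l`, then, the inactive ones staying below `G ρ` by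
  -- continuity, the envelope would fall below its minimum. Used from the right and from the left.
  have active : ∀ l : Filter ℝ, l.NeBot → l ≤ 𝓝 ρ → (∀ᶠ ρ' in l, 0 ≤ ρ') →
      ∃ k, A k + ρ * B k = G ρ ∧ ¬ ∀ᶠ ρ' in l, (ρ' - ρ) * B k < 0 := by
    intro l hl hlρ hpos
    by_contra! hcon
    have h1 : ∀ᶠ ρ' in l, ∀ k, A k + ρ' * B k < G ρ := by
      refine eventually_all.2 fun k => ?_
      rcases (hle ρ k).lt_or_eq with h | h
      · have : ContinuousAt (fun ρ' => A k + ρ' * B k) ρ := by fun_prop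
        exact (this.eventually_lt continuousAt_const h).filter_mono hlρ
      · filter_upwards [hcon k h] with ρ' hρ'
        linarith
    obtain ⟨ρ', h2, h3⟩ := (h1.and hpos).exists
    have h4 := hmin' ρ' h3
    obtain ⟨k, -, hk⟩ := Finset.exists_mem_eq_sup' hne fun k => A k + ρ' * B k
    have h5 : G ρ' = A k + ρ' * B k := hk
    have h6 := h2 k
    linarith
  obtain ⟨k₁, h1, h1'⟩ := active (𝓝[>] ρ) inferInstance nhdsWithin_le_nhds (by
    filter_upwards [self_mem_nhdsWithin] with ρ' hρ'
    exact hρ.1.trans (Set.mem_Ioi.1 hρ').le)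
  have hB1 : 0 ≤ B k₁ := by
    by_contra! h
    refine h1' ?_
    filter_upwards [self_mem_nhdsWithin] with ρ' hρ'
    exact mul_neg_of_pos_of_neg (sub_pos.2 hρ') h
  rcases hρ.1.eq_or_lt with h0 | h0
  · refine ⟨ρ, hρ.1, k₁, k₁, 1, zero_le_one, le_rfl, fun k => ?_, by linarith⟩
    have h2 := hle ρ k
    rw [← h1, ← h0] at h2
    rw [← h0]
    linarith
  · obtain ⟨k₂, h2, h2'⟩ := active (𝓝[<] ρ) inferInstance nhdsWithin_le_nhds (by
      filter_upwards [(lt_mem_nhds h0).filter_mono nhdsWithin_le_nhds] with ρ' hρ'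
      exact hρ'.le)
    have hB2 : B k₂ ≤ 0 := by
      by_contra! h
      refine h2' ?_
      filter_upwards [self_mem_nhdsWithin] with ρ' hρ'
      exact mul_neg_of_neg_of_pos (sub_neg.2 hρ') h
    have key : ∀ θ, 0 ≤ θ → θ ≤ 1 → θ * B k₁ + (1 - θ) * B k₂ = 0 →
        ∀ k, A k + ρ * B k ≤ θ * A k₁ + (1 - θ) * A k₂ := by
      intro θ _ _ hθ k
      have h3 : θ * A k₁ + (1 - θ) * A k₂ = G ρ := by
        linear_combination θ * h1 + (1 - θ) * h2 - ρ * hθ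
      rw [h3]
      exact hle ρ k
    -- Equal slopes must both be zero; this case is separated because the weight divides by their
    -- difference.
    rcases (sub_nonneg.2 (hB2.trans hB1)).eq_or_lt with h3 | h3
    · have h4 : (1 : ℝ) * B k₁ + (1 - 1) * B k₂ = 0 := by linarith
      exact ⟨ρ, hρ.1, k₁, k₂, 1, zero_le_one, le_rfl, key 1 zero_le_one le_rfl h4, h4.ge⟩
    · have h4 : (-B k₂ / (B k₁ - B k₂)) * B k₁ + (1 - -B k₂ / (B k₁ - B k₂)) * B k₂ = 0 := by
        field_simp
        ring
      have h5 : 0 ≤ -B k₂ / (B k₁ - B k₂) := div_nonneg (by linarith) h3.le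
      have h6 : -B k₂ / (B k₁ - B k₂) ≤ 1 := by
        rw [div_le_one h3]
        linarith
      exact ⟨ρ, hρ.1, k₁, k₂, _, h5, h6, key _ h5 h6 h4, h4.ge⟩

/-! ### Mixtures of two empirical distributions -/

section Mixture

variable {X Y : Type*} [MeasurableSpace X] [MeasurableSpace Y] {R : ℕ}

/-- The mixture, with weights `θ` and `1 - θ`, of the empirical distributions of `p` and `q`. -/
noncomputable def mixture (θ : ℝ) (p q : Fin R → X) : Measure X :=
  (R : ℝ≥0∞)⁻¹ • ∑ r, (ENNReal.ofReal θ • Measure.dirac (p r)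
    + ENNReal.ofReal (1 - θ) • Measure.dirac (q r))

theorem map_mixture (θ : ℝ) (p q : Fin R → X) {f : X → Y} (hf : Measurable f) :
    (mixture θ p q).map f = mixture θ (f ∘ p) (f ∘ q) := by
  unfold mixture
  simp only [← Measure.mapₗ_apply_of_measurable hf, map_smul, map_sum, map_add]
  simp only [Measure.mapₗ_apply_of_measurable hf, Measure.map_dirac' hf, Function.comp_apply]

theorem ofReal_add_ofReal_one_sub {θ : ℝ} (h0 : 0 ≤ θ) (h1 : θ ≤ 1) :
    ENNReal.ofReal θ + ENNReal.ofReal (1 - θ) = 1 := by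
  rw [← ENNReal.ofReal_add h0 (by linarith)]
  simp

theorem mixture_self {θ : ℝ} (h0 : 0 ≤ θ) (h1 : θ ≤ 1) (p : Fin R → X) :
    mixture θ p p = (R : ℝ≥0∞)⁻¹ • ∑ r, Measure.dirac (p r) := by
  unfold mixture
  simp only [← add_smul, ofReal_add_ofReal_one_sub h0 h1, one_smul]

theorem isProbabilityMeasure_mixture (hR : 0 < R) {θ : ℝ} (h0 : 0 ≤ θ) (h1 : θ ≤ 1)
    (p q : Fin R → X) : IsProbabilityMeasure (mixture θ p q) := by
  refine ⟨?_⟩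
  simp only [mixture, Measure.smul_apply, Measure.finsetSum_apply, Measure.add_apply,
    measure_univ, smul_eq_mul, mul_one, ofReal_add_ofReal_one_sub h0 h1, Finset.sum_const,
    Finset.card_univ, Fintype.card_fin, nsmul_eq_mul]
  exact ENNReal.inv_mul_cancel (by simpa using hR.ne') (ENNReal.natCast_ne_top R)

theorem mixture_compl_eq_zero [MeasurableSingletonClass X] (θ : ℝ) {p q : Fin R → X} {S : Set X}
    (hp : ∀ r, p r ∈ S) (hq : ∀ r, q r ∈ S) : mixture θ p q Sᶜ = 0 := by
  simp [mixture, Measure.smul_apply, Measure.finsetSum_apply, Measure.add_apply,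
    Measure.dirac_apply, hp, hq]

theorem integrable_mixture [MeasurableSingletonClass X] (hR : 0 < R) (θ : ℝ) (p q : Fin R → X)
    (g : X → ℝ) : Integrable g (mixture θ p q) := by
  unfold mixture
  refine Integrable.smul_measure ?_ (by simpa using hR.ne')
  refine integrable_finsetSum_measure.2 fun r _ => ?_
  exact ((integrable_dirac (by simp)).smul_measure ENNReal.ofReal_ne_top).add_measure
    ((integrable_dirac (by simp)).smul_measure ENNReal.ofReal_ne_top)

theorem integral_mixture [MeasurableSingletonClass X] {θ : ℝ} (h0 : 0 ≤ θ) (h1 : θ ≤ 1)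
    (p q : Fin R → X) (g : X → ℝ) :
    ∫ z, g z ∂(mixture θ p q) = (R : ℝ)⁻¹ * ∑ r, (θ * g (p r) + (1 - θ) * g (q r)) := by
  have hi : ∀ (c : ℝ) (z : X), Integrable g (ENNReal.ofReal c • Measure.dirac z) := fun c z =>
    (integrable_dirac (by simp)).smul_measure ENNReal.ofReal_ne_top
  unfold mixture
  rw [integral_smul_measure, integral_finsetSum_measure fun r _ => (hi _ _).add_measure (hi _ _)]
  simp only [integral_add_measure (hi _ _) (hi _ _), integral_smul_measure, integral_dirac,
    ENNReal.toReal_ofReal h0, ENNReal.toReal_ofReal (sub_nonneg.2 h1), smul_eq_mul,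
    ENNReal.toReal_inv, ENNReal.toReal_natCast]

end Mixture

theorem empirical_eq_mixture {N R : ℕ} (s : Fin R → Scenario N) : empirical s = mixture 1 s s :=
  (mixture_self zero_le_one le_rfl s).symm

theorem continuous_l1dist {N : ℕ} :
    Continuous fun p : Scenario N × Scenario N => l1dist p.1 p.2 := by
  unfold l1dist
  fun_prop

theorem l1dist_nonneg {N : ℕ} (ξ ξ' : Scenario N) : 0 ≤ l1dist ξ ξ' :=
  add_nonneg (Finset.sum_nonneg fun _ _ => abs_nonneg _) (Finset.sum_nonneg fun _ _ => abs_nonneg _)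

theorem l1dist_self {N : ℕ} (ξ : Scenario N) : l1dist ξ ξ = 0 := by simp [l1dist]

/-! ### The Wasserstein ball -/

namespace HRASData

variable {N R : ℕ} {D : HRASData N}

theorem isClosed_support : IsClosed D.support := by
  have h1 : ∀ p, Continuous fun ξ : Scenario N => ξ.1 p := fun p => by fun_prop
  have h2 : ∀ i, Continuous fun ξ : Scenario N => ξ.2 i := fun i => by fun_prop
  simp only [support, Set.ofPred_and, Set.ofPred_forall]
  refine (isClosed_iInter fun p => ?_).inter (isClosed_iInter fun i => ?_)
  · exact (isClosed_le continuous_const (h1 p)).inter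
      ((isClosed_le continuous_const (h1 p)).inter (isClosed_le (h1 p) continuous_const))
  · exact (isClosed_le continuous_const (h2 i)).inter
      ((isClosed_le continuous_const (h2 i)).inter (isClosed_le (h2 i) continuous_const))

theorem isCompact_support : IsCompact D.support :=
  isCompact_Icc.of_isClosed_subset isClosed_support fun _ hξ =>
    (⟨⟨fun p => (hξ.1 p).2.1, fun i => (hξ.2 i).2.1⟩,
      ⟨fun p => (hξ.1 p).2.2, fun i => (hξ.2 i).2.2⟩⟩ : _ ∈ Set.Icc D.lo D.hi)

theorem integrable_of_continuous {Q : Measure (Scenario N)} [IsProbabilityMeasure Q]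
    (hQ : Q D.supportᶜ = 0) {f : Scenario N → ℝ} (hf : Continuous f) : Integrable f Q := by
  obtain ⟨C, hC⟩ := isCompact_support.exists_bound_of_continuousOn hf.continuousOn
  refine Integrable.of_bound hf.aestronglyMeasurable C ?_
  filter_upwards [mem_ae_iff.2 hQ] with ξ hξ using hC ξ hξ

/-- Weak duality for the Wasserstein ball. -/
theorem integral_le_of_mem_ambiguitySet (hR : 0 < R) {s : Fin R → Scenario N}
    {ε : ℝ} (hε : 0 < ε) {Q : Measure (Scenario N)} (hQ : Q ∈ D.ambiguitySet s ε)
    {f : Scenario N → ℝ} (hf : Continuous f) {ρ : ℝ} (hρ : 0 ≤ ρ) {c : Fin R → ℝ}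
    (hc : ∀ r, ∀ ξ ∈ D.support, f ξ ≤ c r + ρ * l1dist ξ (s r)) :
    ∫ ξ, f ξ ∂Q ≤ ε * ρ + (R : ℝ)⁻¹ * ∑ r, c r := by
  obtain ⟨hprob, hsupp, hW⟩ := hQ
  have hne : D.support.Nonempty := by
    by_contra h
    rw [Set.not_nonempty_iff_eq_empty] at h
    simp [h] at hsupp
  have : Nonempty D.support := hne.to_subtype
  -- Samples may coincide, so `c r` need not be a function of the point `s r`; this supremum is, and
  -- it lies below every such `c r`. Its measurability is not an issue, as the empirical
  -- distribution has finitely many atoms.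
  let Φ : Scenario N → ℝ := fun ξ' => ⨆ ξ : D.support, (f ξ - ρ * l1dist ξ ξ')
  have hΦle : ∀ r, Φ (s r) ≤ c r := fun r => ciSup_le fun ξ => by linarith [hc r ξ ξ.2]
  have hleΦ : ∀ r, ∀ ξ ∈ D.support, f ξ ≤ Φ (s r) + ρ * l1dist ξ (s r) := by
    intro r ξ hξ
    have h1 : f ξ - ρ * l1dist ξ (s r) ≤ Φ (s r) :=
      le_ciSup (f := fun ξ : D.support => f ξ - ρ * l1dist ξ (s r))
        ⟨c r, by rintro _ ⟨ξ', rfl⟩; linarith [hc r ξ' ξ'.2]⟩ ⟨ξ, hξ⟩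
    linarith
  refine le_of_forall_pos_le_add fun δ' hδ' => ?_
  -- The infimum over couplings need not be attained, so a coupling of cost below `ε + δ` is used;
  -- dividing by `ρ + 1` covers `ρ = 0`.
  obtain ⟨δ, hδ, hδδ⟩ : ∃ δ, 0 < δ ∧ ρ * δ ≤ δ' := by
    refine ⟨δ' / (ρ + 1), by positivity, ?_⟩
    rw [mul_div_assoc', div_le_iff₀ (by positivity)]
    nlinarith
  have hlt : wasserstein₁ Q (empirical s) < ENNReal.ofReal (ε + δ) :=
    hW.trans_lt ((ENNReal.ofReal_lt_ofReal_iff (by linarith)).2 (by linarith))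
  simp only [wasserstein₁, iInf_lt_iff] at hlt
  obtain ⟨P, ⟨hP1, hP2⟩, hP⟩ := hlt
  have hPprob : IsProbabilityMeasure P := by
    refine ⟨?_⟩
    rw [← Set.preimage_univ (f := Prod.fst), ← Measure.map_apply measurable_fst .univ, hP1]
    exact hprob.measure_univ
  have hi1 : Integrable (fun p : Scenario N × Scenario N => f p.1) P := by
    have h := integrable_of_continuous hsupp hf
    rw [← hP1] at h
    exact h.comp_measurable measurable_fst
  have hi2 : Integrable (fun p : Scenario N × Scenario N => Φ p.2) P := by
    have h : Integrable Φ (empirical s) := by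
      rw [empirical_eq_mixture]
      exact integrable_mixture hR _ _ _ _
    rw [← hP2] at h
    exact h.comp_measurable measurable_snd
  have hl : ∫⁻ p, ENNReal.ofReal (l1dist p.1 p.2) ∂P ≠ ⊤ := (hP.trans ENNReal.ofReal_lt_top).ne
  have hi3 : Integrable (fun p : Scenario N × Scenario N => l1dist p.1 p.2) P := by
    refine ⟨continuous_l1dist.aestronglyMeasurable, ?_⟩
    rw [hasFiniteIntegral_iff_ofReal (Filter.Eventually.of_forall fun p => l1dist_nonneg _ _)]
    exact hl.lt_top
  have hI3 : ∫ p, l1dist p.1 p.2 ∂P ≤ ε + δ := by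
    rw [integral_eq_lintegral_of_nonneg_ae (Filter.Eventually.of_forall fun p => l1dist_nonneg _ _)
      continuous_l1dist.aestronglyMeasurable]
    exact ENNReal.toReal_le_of_le_ofReal (by linarith) hP.le
  have hI2 : ∫ p, Φ p.2 ∂P ≤ (R : ℝ)⁻¹ * ∑ r, c r := by
    have h : ∫ ξ, Φ ξ ∂(empirical s) = ∫ p, Φ p.2 ∂P := by
      have h' : AEStronglyMeasurable Φ (P.map Prod.snd) := by
        rw [hP2, empirical_eq_mixture]
        exact (integrable_mixture hR _ _ _ _).aestronglyMeasurable
      rw [← hP2, integral_map measurable_snd.aemeasurable h']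
    rw [← h, empirical_eq_mixture, integral_mixture zero_le_one le_rfl]
    refine mul_le_mul_of_nonneg_left (Finset.sum_le_sum fun r _ => ?_) (by positivity)
    linarith [hΦle r]
  have hI1 : ∫ ξ, f ξ ∂Q = ∫ p, f p.1 ∂P := by
    rw [← hP1, integral_map measurable_fst.aemeasurable hf.aestronglyMeasurable]
  have hae : ∀ᵐ p ∂P, f p.1 ≤ Φ p.2 + ρ * l1dist p.1 p.2 := by
    have h1 : ∀ᵐ p ∂P, p.1 ∈ D.support := by
      refine ae_of_ae_map (p := fun ξ => ξ ∈ D.support) measurable_fst.aemeasurable ?_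
      rw [hP1]
      exact mem_ae_iff.2 hsupp
    have h2 : ∀ᵐ p ∂P, p.2 ∈ Set.range s := by
      refine ae_of_ae_map (p := fun ξ => ξ ∈ Set.range s) measurable_snd.aemeasurable ?_
      rw [hP2, empirical_eq_mixture]
      exact mem_ae_iff.2 (mixture_compl_eq_zero _ (fun r => ⟨r, rfl⟩) fun r => ⟨r, rfl⟩)
    filter_upwards [h1, h2] with p hp1 hp2
    obtain ⟨r, hr⟩ := hp2
    rw [← hr]
    exact hleΦ r _ hp1
  have hfin := integral_mono_ae hi1 (hi2.add (hi3.const_mul ρ)) hae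
  simp only [Pi.add_apply] at hfin
  rw [integral_add hi2 (hi3.const_mul ρ), integral_const_mul] at hfin
  have h5 := mul_le_mul_of_nonneg_left hI3 hρ
  rw [hI1]
  linarith

theorem mixture_mem_ambiguitySet (hR : 0 < R) {s : Fin R → Scenario N} {ε θ : ℝ}
    (h0 : 0 ≤ θ) (h1 : θ ≤ 1) {p q : Fin R → Scenario N} (hp : ∀ r, p r ∈ D.support)
    (hq : ∀ r, q r ∈ D.support)
    (hε : (R : ℝ)⁻¹ * ∑ r, (θ * l1dist (p r) (s r) + (1 - θ) * l1dist (q r) (s r)) ≤ ε) :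
    mixture θ p q ∈ D.ambiguitySet s ε := by
  refine ⟨isProbabilityMeasure_mixture hR h0 h1 p q, mixture_compl_eq_zero θ hp hq, ?_⟩
  -- The coupling sends both atoms belonging to index `r` to the sample `s r`.
  let P : Measure (Scenario N × Scenario N) :=
    mixture θ (fun r => (p r, s r)) (fun r => (q r, s r))
  have hP1 : P.map Prod.fst = mixture θ p q := map_mixture _ _ _ measurable_fst
  have hP2 : P.map Prod.snd = empirical s :=
    (map_mixture _ _ _ measurable_snd).trans (mixture_self h0 h1 s)
  refine (iInf₂_le P ⟨hP1, hP2⟩).trans ?_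
  rw [← ofReal_integral_eq_lintegral_ofReal (integrable_mixture hR _ _ _ _)
    (Filter.Eventually.of_forall fun p => l1dist_nonneg _ _), integral_mixture h0 h1]
  exact ENNReal.ofReal_le_ofReal hε

end HRASData

/-! ### Equivalence of the two models -/

namespace HRASData

variable {N R : ℕ} {D : HRASData N}

theorem CostsOk.continuous_cost_right (hN : 0 < N) (hD : D.CostsOk) (x : Fin N → Fin N → ℝ)
    (a : Fin N → ℝ) : Continuous (D.cost x a) := by
  have h : Continuous fun ξ : Scenario N => (a, ξ) := by fun_prop
  simpa only [Function.comp_def] using (hD.continuous_cost hN x).comp h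

theorem CostsOk.continuous_cost_left (hN : 0 < N) (hD : D.CostsOk) (x : Fin N → Fin N → ℝ)
    (ξ : Scenario N) : Continuous fun a => D.cost x a ξ := by
  have h : Continuous fun a : Fin N → ℝ => (a, ξ) := by fun_prop
  simpa only [Function.comp_def] using (hD.continuous_cost hN x).comp h

theorem CostsOk.integral_cost_le_milpObj (hN : 0 < N) (hR : 0 < R) (hD : D.CostsOk)
    (hlam : 0 ≤ D.lam) {s : Fin R → Scenario N} (hs : ∀ r, s r ∈ D.support) {ε : ℝ} (hε : 0 < ε)
    {y : MILPVars N R} (hy : D.MILPFeasible s y) {Q : Measure (Scenario N)}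
    (hQ : Q ∈ D.ambiguitySet s ε) : ∫ ξ, D.cost y.x y.a ξ ∂Q ≤ D.milpObj ε y := by
  refine integral_le_of_mem_ambiguitySet hR hε hQ (hD.continuous_cost_right hN y.x y.a)
    hy.rho_nonneg fun r ξ hξ => ?_
  have h1 := hD.cost_le hN hlam (hs r) hξ hy.route hy.rho_nonneg (hy.dominates r)
  have h2 := hy.sum_uRetVal_le r
  simp only [Finset.Icc_eq_empty (by omega : ¬ 1 ≤ 0), Finset.sum_empty, sub_zero] at h1
  linarith

/-- For fixed `(x, a)` some point of the MILP is matched by a worst-case distribution, whose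
expected cost depends continuously on the schedule. -/
theorem CostsOk.exists_milpObj_le_integral (hN : 0 < N) (hR : 0 < R) (hD : D.CostsOk)
    (hlam : 0 ≤ D.lam) (hlo_t : ∀ p, 0 ≤ D.lo.1 p) (hlo_d : ∀ i, 0 ≤ D.lo.2 i)
    {s : Fin R → Scenario N} (hs : ∀ r, s r ∈ D.support) {ε : ℝ} (hε : 0 < ε)
    {x : Fin N → Fin N → ℝ} (hx : IsRoute x) {a : Fin N → ℝ} (ha : D.IsSchedule a) :
    ∃ y : MILPVars N R, D.MILPFeasible s y ∧ y.x = x ∧ y.a = a ∧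
      ∃ Q ∈ D.ambiguitySet s ε, D.milpObj ε y ≤ ∫ ξ, D.cost x a ξ ∂Q ∧
        Continuous fun a' => ∫ ξ, D.cost x a' ξ ∂Q := by
  have := fun r => (D.finite_corners (s r)).to_subtype
  -- An index `k` picks one corner for each sample. Keeping every sample in place leaves the whole
  -- budget `ε > 0`, as `exists_saddle` requires.
  let A : (∀ r, D.corners (s r)) → ℝ := fun k => (R : ℝ)⁻¹ * ∑ r, D.cost x a (k r)
  let B : (∀ r, D.corners (s r)) → ℝ := fun k => ε - (R : ℝ)⁻¹ * ∑ r, l1dist (k r : Scenario N) (s r)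
  obtain ⟨ρ, hρ, k₁, k₂, θ, h0, h1, hA, hB⟩ := exists_saddle A B
    (k₀ := fun r => ⟨s r, mem_corners_self (s r)⟩) (by simpa [B, l1dist_self] using hε)
  choose β hβ ξ hξ hcost using fun r => hD.exists_dominates_corner hN hlam (hs r) hx a hρ
  have hcs := fun r => corners_subset_support hlo_t hlo_d (hs r)
  refine ⟨D.explicitPoint s x a ρ β, milpFeasible_explicitPoint hlam hs hx ha hρ hβ, rfl, rfl,
    mixture θ (fun r => (k₁ r : Scenario N)) (fun r => (k₂ r : Scenario N)), ?_, ?_, ?_⟩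
  · refine mixture_mem_ambiguitySet hR h0 h1 (fun r => hcs r (k₁ r).2)
      (fun r => hcs r (k₂ r).2) ?_
    rw [Finset.sum_add_distrib, ← Finset.mul_sum, ← Finset.mul_sum]
    simp only [B] at hB
    linarith
  · rw [milpObj_explicitPoint, integral_mixture h0 h1,
      Finset.sum_add_distrib (f := fun r => θ * D.cost x a (k₁ r)), ← Finset.mul_sum,
      ← Finset.mul_sum]
    -- The selection maximising the penalised cost sample by sample is one of the competitors, so
    -- the saddle value bounds the MILP objective at `ρ`.
    have h2 := hA fun r => ⟨ξ r, hξ r⟩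
    simp only [A, B] at h2
    have h3 : (R : ℝ)⁻¹ * ∑ r, (β r (N + 2) - β r 0 + ∑ i, D.uRetVal (s r) i ρ * ent (x i) N) ≤
        (R : ℝ)⁻¹ * ∑ r, (D.cost x a (ξ r) - ρ * l1dist (ξ r) (s r)) :=
      mul_le_mul_of_nonneg_left (Finset.sum_le_sum fun r _ => hcost r) (by positivity)
    rw [Finset.sum_sub_distrib, ← Finset.mul_sum] at h3
    linarith
  · simp only [integral_mixture h0 h1]
    have := fun ξ => hD.continuous_cost_left hN x ξ
    fun_prop

end HRASData

/-! ### First-stage decisions and the main theorem. -/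

theorem exists_isRoute (N : ℕ) : ∃ x : Fin N → Fin N → ℝ, IsRoute x :=
  ⟨fun i j => if i = j then 1 else 0, fun j => by simp, fun i => by simp, fun i j => by
    by_cases h : i = j <;> simp [h]⟩

theorem finite_isRoute (N : ℕ) : {x : Fin N → Fin N → ℝ | IsRoute x}.Finite := by
  refine (Set.Finite.pi (t := fun _ : Fin N => Set.univ.pi fun _ : Fin N => ({0, 1} : Set ℝ))
    fun i => Set.Finite.pi fun j => Set.toFinite _).subset ?_
  intro x hx i _ j _
  simpa using hx.2.2 i j

theorem HRASData.isCompact_isSchedule {N : ℕ} (D : HRASData N) :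
    IsCompact {a : Fin N → ℝ | D.IsSchedule a} := by
  refine (isCompact_univ_pi fun _ => isCompact_Icc (a := 0) (b := D.L)).of_isClosed_subset ?_
    fun a ha j _ => ha.1 j
  have h1 : ∀ j, Continuous fun a : Fin N → ℝ => a j := fun j => by fun_prop
  simp only [HRASData.IsSchedule, Set.ofPred_and, Set.ofPred_forall]
  refine (isClosed_iInter fun j => ?_).inter (isClosed_iInter fun j => isClosed_iInter fun _ => ?_)
  · exact (isClosed_le continuous_const (h1 j)).inter (isClosed_le (h1 j) continuous_const)
  · exact isClosed_le (continuous_ent _) (continuous_ent _)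

theorem HRASData.isSchedule_zero {N : ℕ} {D : HRASData N} (hL : 0 ≤ D.L) : D.IsSchedule 0 := by
  refine ⟨fun j => ⟨le_rfl, hL⟩, fun j _ => ?_⟩
  simp [ent]

/-- **MILP reformulation of W-DHRAS.** -/
theorem mainTheorem2 {N R : ℕ} (hN : 0 < N) (hR : 0 < R) (D : HRASData N)
    (hL : 0 ≤ D.L) (hcw : ∀ j, 0 ≤ D.cw j) (hcu : ∀ j, 0 ≤ D.cu j) (hco : 0 ≤ D.co)
    (hlam : 0 ≤ D.lam)
    (hmono : ∀ j j' : Fin N, (j' : ℕ) = j + 1 → D.cu j' ≤ D.cu j + D.cw j)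
    (hlo_t : ∀ p, 0 ≤ D.lo.1 p) (hlo_d : ∀ i, 0 ≤ D.lo.2 i)
    (s : Fin R → Scenario N) (hs : ∀ r, s r ∈ D.support) (ε : ℝ) (hε : 0 < ε) :
    -- for fixed first-stage decisions: all minima, expectations and suprema are genuine, and the
    -- worst-case expected cost is the (attained) optimal value of the MILP restricted to `(x, a)`
    (∀ x a, IsRoute x → D.IsSchedule a →
      (∀ ξ, IsLeast (D.secondStageValues x a ξ) (D.cost x a ξ)) ∧
      (∀ Q ∈ D.ambiguitySet s ε, Integrable (D.cost x a) Q) ∧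
      IsLUB (D.expectedCosts s ε x a) (D.worstCase s ε x a) ∧
      IsLeast (D.milpValuesAt s ε x a) (D.worstCase s ε x a)) ∧
    -- both problems attain the same optimal value
    (∃ Z : ℝ, IsLeast (D.wdhrasValues s ε) Z ∧ IsLeast (D.milpValues s ε) Z) ∧
    -- and have the same optimal first-stage decisions
    (∀ x a, D.IsWDHRASOptimal s ε x a ↔
      ∃ y : MILPVars N R, D.IsMILPOptimal s ε y ∧ y.x = x ∧ y.a = a) ∧
    -- the linearisation is exact and the bounds used in it are tight
    (∀ y : MILPVars N R, D.MILPFeasible s y → D.ProductsExact y) ∧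
    D.BoundsTight s := by
  have hD := HRASData.costsOk hcw hcu hco hmono
  have hfix : ∀ x a, IsRoute x → D.IsSchedule a →
      IsLUB (D.expectedCosts s ε x a) (D.worstCase s ε x a) ∧
      IsLeast (D.milpValuesAt s ε x a) (D.worstCase s ε x a) ∧
      ∃ g : (Fin N → ℝ) → ℝ, Continuous g ∧ g a = D.worstCase s ε x a ∧
        ∀ a', g a' ∈ D.expectedCosts s ε x a' := by
    intro x a hx ha
    obtain ⟨y, hy, rfl, rfl, Q, hQ, hle, hcont⟩ :=
      hD.exists_milpObj_le_integral hN hR hlam hlo_t hlo_d hs hε hx ha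
    have hub : ∀ y' : MILPVars N R, D.MILPFeasible s y' → y'.x = y.x → y'.a = y.a →
        D.milpObj ε y' ∈ upperBounds (D.expectedCosts s ε y.x y.a) := by
      rintro y' hy' hxx haa _ ⟨Q', hQ', rfl⟩
      rw [← hxx, ← haa]
      exact hD.integral_cost_le_milpObj hN hR hlam hs hε hy' hQ'
    have hmem : ∫ ξ, D.cost y.x y.a ξ ∂Q ∈ D.expectedCosts s ε y.x y.a := ⟨Q, hQ, rfl⟩
    have heq : D.milpObj ε y = ∫ ξ, D.cost y.x y.a ξ ∂Q :=
      le_antisymm hle (hub y hy rfl rfl hmem)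
    have hgr : IsGreatest (D.expectedCosts s ε y.x y.a) (D.milpObj ε y) :=
      ⟨heq ▸ hmem, hub y hy rfl rfl⟩
    have hwc : D.worstCase s ε y.x y.a = D.milpObj ε y := hgr.csSup_eq
    rw [hwc]
    refine ⟨hgr.isLUB, ⟨⟨y, hy, rfl, rfl, rfl⟩, ?_⟩, _, hcont, heq.symm, fun a' => ⟨Q, hQ, rfl⟩⟩
    rintro _ ⟨y', hy', hxx, haa, rfl⟩
    exact hub y' hy' hxx haa hgr.1
  have hmilp : ∀ y : MILPVars N R, D.MILPFeasible s y →
      D.worstCase s ε y.x y.a ≤ D.milpObj ε y := fun y hy =>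
    (hfix y.x y.a hy.route hy.schedule).2.1.2 ⟨y, hy, rfl, rfl, rfl⟩
  have hsched : ∀ x, IsRoute x → ∃ a, D.IsSchedule a ∧
      ∀ a', D.IsSchedule a' → D.worstCase s ε x a ≤ D.worstCase s ε x a' := by
    intro x hx
    -- The ambiguity set does not depend on `a`. The expected cost under a distribution that is
    -- worst at `a` is continuous, lies below the worst case at every schedule, and touches it at
    -- `a`.
    have hlsc : LowerSemicontinuousOn (D.worstCase s ε x) {a | D.IsSchedule a} := by
      intro a ha z hz
      obtain ⟨-, -, g, hg, hga, hgm⟩ := hfix x a hx ha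
      rw [← hga] at hz
      filter_upwards [(hg.continuousAt.eventually (lt_mem_nhds hz)).filter_mono nhdsWithin_le_nhds,
        self_mem_nhdsWithin] with a' h1 h2
      exact lt_of_lt_of_le h1 ((hfix x a' hx h2).1.1 (hgm a'))
    obtain ⟨a, ha, hmin⟩ := hlsc.exists_isMinOn ⟨0, HRASData.isSchedule_zero hL⟩
      D.isCompact_isSchedule
    exact ⟨a, ha, fun a' ha' => hmin ha'⟩
  refine ⟨fun x a hx ha => ⟨fun ξ => ?_, fun Q hQ => ?_, (hfix x a hx ha).1, (hfix x a hx ha).2.1⟩,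
    ?_, fun x a => ⟨?_, ?_⟩, fun y hy => hy.productsExact, HRASData.boundsTight hlam hs⟩
  · rw [hD.cost_eq hN]
    exact hD.isLeast_greedyCost hN x a ξ
  · have := hQ.1
    exact HRASData.integrable_of_continuous hQ.2.1 (hD.continuous_cost_right hN x a)
  · choose! α hα hαmin using hsched
    obtain ⟨x, hx, hmin⟩ := Set.exists_min_image _ (fun x => D.worstCase s ε x (α x))
      (finite_isRoute N) (exists_isRoute N)
    have hbest : ∀ x' a', IsRoute x' → D.IsSchedule a' →
        D.worstCase s ε x (α x) ≤ D.worstCase s ε x' a' := fun x' a' hx' ha' =>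
      (hmin x' hx').trans (hαmin x' hx' a' ha')
    refine ⟨D.worstCase s ε x (α x), ⟨⟨x, α x, hx, hα x hx, rfl⟩, ?_⟩, ?_, ?_⟩
    · rintro _ ⟨x', a', hx', ha', rfl⟩
      exact hbest x' a' hx' ha'
    · obtain ⟨y, hy, -, -, hz⟩ := (hfix x (α x) hx (hα x hx)).2.1.1
      exact ⟨y, hy, hz⟩
    · rintro _ ⟨y, hy, rfl⟩
      exact (hbest _ _ hy.route hy.schedule).trans (hmilp y hy)
  · rintro ⟨hx, ha, hopt⟩
    obtain ⟨y, hy, hyx, hya, hz⟩ := (hfix x a hx ha).2.1.1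
    refine ⟨y, ⟨hy, ?_⟩, hyx, hya⟩
    rintro _ ⟨y', hy', rfl⟩
    rw [← hz]
    exact (hopt ⟨_, _, hy'.route, hy'.schedule, rfl⟩).trans (hmilp y' hy')
  · rintro ⟨y, ⟨hy, hopt⟩, rfl, rfl⟩
    refine ⟨hy.route, hy.schedule, ?_⟩
    rintro _ ⟨x', a', hx', ha', rfl⟩
    obtain ⟨y', hy', -, -, hz⟩ := (hfix x' a' hx' ha').2.1.1
    exact (hmilp y hy).trans (hopt ⟨y', hy', hz⟩)
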